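/- Consider batteries made of $n$ two-level cells, each with Hamiltonian $\hat h=|1\rangle\langle 1|$, total Hamiltonian $\hat H^{(n)}=\sum_{i=1}^n\hat h_i$, and mean energy $\mathfrak E(\rho)=\mathrm{Tr}[\rho \hat H^{(n)}]$. The ergotropy of a state $\rho$ of the $n$ cells is $\mathcal E(\rho)=\max_U\{\mathfrak E(\rho)-\mathfrak E(U\rho U^\dagger)\}$ over all unitaries $U$, and the local ergotropy $\mathcal E_{\rm loc}(\rho)$ is the same maximum over the product unitaries $U=U_1\otimes\cdots\otimes U_n$. For a single-cell channel $\Lambda$ let $\mathcal E^{(n)}(\Lambda;E)=\max_\rho \mathcal E(\Lambda^{\otimes n}(\rho))$ over the density matrices $\rho$ of $n$ cells with $\mathfrak E(\rho)\le E$, and $$\mathcal J_{\mathcal E}(\Lambda)=\limsup_{E\to\infty}\ \sup_{n\ge\lceil E\rceil}\frac{\mathcal E^{(n)}(\Lambda;E)}{E}\in[-\infty,\infty].$$ The separable-input, local, and separable-input local maximal asymptotic work/energy ratios (MAWERs) $\mathcal J_{\rm sep}(\Lambda)$, $\mathcal J_{\rm loc}(\Lambda)$, $\mathcal J_{\rm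 loc,sep}(\Lambda)$ are defined in the same way with, respectively, $\rho$ restricted to (fully) separable states, $\mathcal E$ replaced by $\mathcal E_{\rm loc}$, and both. Let $\gamma\in[0,1]$ and $\eta\in[0,1/2]$ with $(\gamma,\eta)\ne(1,1/2)$. Let $$\Phi_{\gamma,\eta}(\rho)=\begin{pmatrix}1-\gamma\eta-(1-\gamma)\rho_{11}&\sqrt{1-\gamma}\,\rho_{01}\\ \sqrt{1-\gamma}\,\rho_{10}&\gamma\eta+(1-\gamma)\rho_{11}\end{pmatrix}$$ be the generalized amplitude damping channel (on density matrices, extended linearly), and $$\Phi_\gamma(\rho)=\begin{pmatrix}\rho_{00}+\gamma\rho_{11}&\sqrt{1-\gamma}\,\rho_{01}\\ \sqrt{1-\gamma}\,\rho_{10}&(1-\gamma)\rho_{11}\end{pmatrix}$$ the amplitude damping channel. Then: 1. $\displaystyle \mathcal J_{\rm sep}(\Phi_{\gamma,\eta})=\mathcal J_{\rm loc}(\Phi_{\gamma,\eta})=\mathcal J_{\rm loc,sep}(\Phi_{\gamma,\eta})=\frac{1-\gamma}{1-2\eta\gamma}.$ 2. This value is attained by coherent product inputs. For $E>0$ and $n\ge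 E$ let $\rho_{n,E}=(|\psi_{E/n}\rangle\langle\psi_{E/n}|)^{\otimes n}$ with $|\psi_{e}\rangle=\sqrt{1-e}\,|0\rangle+\sqrt e\,|1\rangle$; this is a separable state of mean energy exactly $E$. For every $E>0$, $$\lim_{n\to\infty}\frac{\mathcal E(\Phi_{\gamma,\eta}^{\otimes n}(\rho_{n,E}))}{E}=\lim_{n\to\infty}\frac{\mathcal E_{\rm loc}(\Phi_{\gamma,\eta}^{\otimes n}(\rho_{n,E}))}{E}=\frac{1-\gamma}{1-2\eta\gamma}.$$ More precisely there is a constant $C$ depending only on $\gamma,\eta$ such that for all $E>0$ and all integers $n\ge E$ both ratios differ from $\frac{1-\gamma}{1-2\eta\gamma}$ by at most $C\,E/n$. 3. $\mathcal J_{\mathcal E}(\Phi_\gamma)=1-\gamma$, and if $\eta>0$ and $0<\gamma<1$, then each of $\mathcal J_{\rm sep}(\Phi_{\gamma,\eta})$, $\mathcal J_{\rm loc}(\Phi_{\gamma,\eta})$, $\mathcal J_{\rm loc,sep}(\Phi_{\gamma,\eta})$ is strictly larger than $\mathcal J_{\mathcal E}(\Phi_\gamma)$. 4. If $\eta=1/2$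 (hence $\gamma<1$), then $\mathcal J_{\rm sep}(\Phi_{\gamma,\eta})=\mathcal J_{\rm loc}(\Phi_{\gamma,\eta})=\mathcal J_{\rm loc,sep}(\Phi_{\gamma,\eta})=1$. -/

import Mathlib

open Filter Topology
open scoped ComplexOrder

namespace QuantumBattery

noncomputable section

/-- Operators on a single two-level q-cell, in the energy basis `|0⟩, |1⟩`. -/
abbrev QubitOp : Type := Matrix (Fin 2) (Fin 2) ℂ

/-- Operators on `n` two-level q-cells, in the product basis `|a₁⟩ ⊗ ⋯ ⊗ |aₙ⟩`. -/
abbrev CellsOp (n : ℕ) : Type := Matrix (Fin n → Fin 2) (Fin n → Fin 2) ℂ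

/-- The tensor product `A₁ ⊗ ⋯ ⊗ Aₙ` of single-cell operators. -/
def tensor {n : ℕ} (A : Fin n → QubitOp) : CellsOp n :=
  Matrix.of fun a b => ∏ i, A i (a i) (b i)

/-- Density matrices: positive semidefinite with unit trace. -/
def IsDensity {ι : Type*} [Fintype ι] (ρ : Matrix ι ι ℂ) : Prop :=
  ρ.PosSemidef ∧ ρ.trace = 1

/-- (Fully) separable states of the `n` cells: convex combinations of product states. -/
def IsSeparable {n : ℕ} (ρ : CellsOp n) : Prop :=
  ρ ∈ convexHull ℝ {τ : CellsOp n | ∃ σ : Fin n → QubitOp, (∀ i, IsDensity (σ i)) ∧ τ = tensor σ}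

/-- The single-cell Hamiltonian `|1⟩⟨1|` (ground energy `0`, maximal eigenvalue `1`). -/
def cellHamiltonian : QubitOp := !![0, 0; 0, 1]

/-- The battery Hamiltonian `∑ᵢ 1 ⊗ ⋯ ⊗ |1⟩⟨1| ⊗ ⋯ ⊗ 1`, with `|1⟩⟨1|` on the `i`-th cell. -/
def hamiltonian (n : ℕ) : CellsOp n :=
  ∑ i, tensor (Function.update (fun _ => (1 : QubitOp)) i cellHamiltonian)

/-- The mean energy `Tr[ρ H]` of a state of `n` cells. -/
def energy {n : ℕ} (ρ : CellsOp n) : ℝ := (ρ * hamiltonian n).trace.re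

/-- All unitary operators on the `n` cells. -/
def globalUnitaries (n : ℕ) : Set (CellsOp n) :=
  {U | U ∈ Matrix.unitaryGroup (Fin n → Fin 2) ℂ}

/-- The local unitary operators `U₁ ⊗ ⋯ ⊗ Uₙ`. -/
def localUnitaries (n : ℕ) : Set (CellsOp n) :=
  {U | ∃ V : Fin n → QubitOp, (∀ i, V i ∈ Matrix.unitaryGroup (Fin 2) ℂ) ∧ U = tensor V}

/-- The maximal energy decrease of the state `ρ` under the operations `ρ ↦ U ρ U†`, `U ∈ 𝒰`. -/
def extractableWork {n : ℕ} (𝒰 : Set (CellsOp n)) (ρ : CellsOp n) : ℝ :=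
  ⨆ U : 𝒰, (energy ρ - energy (U.1 * ρ * U.1.conjTranspose))

/-- Local unitaries are unitary. -/
theorem localUnitaries_subset (n : ℕ) : localUnitaries n ⊆ globalUnitaries n := by
  rintro U ⟨V, hV, rfl⟩
  rw [globalUnitaries, Set.mem_ofPred_eq, Matrix.mem_unitaryGroup_iff]
  ext a b
  have h : ∀ i, ∑ c, V i (a i) c * star (V i (b i) c) = (1 : QubitOp) (a i) (b i) := fun i => by
    have := congrFun (congrFun (Matrix.mem_unitaryGroup_iff.1 (hV i)) (a i)) (b i)
    simpa [Matrix.mul_apply, Matrix.star_apply] using this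
  simp only [Matrix.mul_apply, Matrix.star_apply, tensor, Matrix.of_apply, star_prod,
    ← Finset.prod_mul_distrib]
  rw [← Fintype.prod_sum (fun i c => V i (a i) c * star (V i (b i) c))]
  simp only [h, Matrix.one_apply]
  by_cases hab : a = b
  · simp [hab]
  · obtain ⟨i, hi⟩ := Function.ne_iff.1 hab
    rw [if_neg hab]
    exact Finset.prod_eq_zero (Finset.mem_univ i) (if_neg hi)

/-- The supremum defining the extractable work is taken over a bounded set of reals. -/
theorem bddAbove_work {n : ℕ} {𝒰 : Set (CellsOp n)} (h𝒰 : 𝒰 ⊆ globalUnitaries n)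
    (ρ : CellsOp n) :
    BddAbove (Set.range fun U : 𝒰 => energy ρ - energy (U.1 * ρ * U.1.conjTranspose)) := by
  refine ⟨energy ρ + ∑ a, ∑ b, ∑ c, ∑ d, ‖ρ d c‖ * ‖hamiltonian n b a‖, ?_⟩
  rintro _ ⟨U, rfl⟩
  have hU : ∀ x y, ‖U.1 x y‖ ≤ 1 := entry_norm_bound_of_unitary (h𝒰 U.2)
  have key : ‖(U.1 * ρ * U.1.conjTranspose * hamiltonian n).trace‖
      ≤ ∑ a, ∑ b, ∑ c, ∑ d, ‖ρ d c‖ * ‖hamiltonian n b a‖ := by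
    simp only [Matrix.trace, Matrix.diag, Matrix.mul_apply, Finset.sum_mul]
    refine (norm_sum_le _ _).trans (Finset.sum_le_sum fun a _ => ?_)
    refine (norm_sum_le _ _).trans (Finset.sum_le_sum fun b _ => ?_)
    refine (norm_sum_le _ _).trans (Finset.sum_le_sum fun c _ => ?_)
    refine (norm_sum_le _ _).trans (Finset.sum_le_sum fun d _ => ?_)
    simp only [norm_mul, Matrix.conjTranspose_apply, norm_star]
    have h1 := hU a d
    have h2 := hU b c
    calc ‖U.1 a d‖ * ‖ρ d c‖ * ‖U.1 b c‖ * ‖hamiltonian n b a‖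
        ≤ 1 * ‖ρ d c‖ * 1 * ‖hamiltonian n b a‖ := by gcongr
      _ = _ := by ring
  have := (abs_le.1 ((Complex.abs_re_le_norm _).trans key)).1
  simp only [energy]
  linarith

/-- The ergotropy of a state of `n` cells. -/
def ergotropy {n : ℕ} (ρ : CellsOp n) : ℝ := extractableWork (globalUnitaries n) ρ

/-- The local ergotropy of a state of `n` cells. -/
def localErgotropy {n : ℕ} (ρ : CellsOp n) : ℝ := extractableWork (localUnitaries n) ρ

/-- The tensor power `Λ^{⊗n}` of a linear map on single-cell operators, given by linear extension
from the matrix units `|c₁⟩⟨d₁| ⊗ ⋯ ⊗ |cₙ⟩⟨dₙ|`. -/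
def channelPower (Λ : QubitOp →ₗ[ℂ] QubitOp) (n : ℕ) (ρ : CellsOp n) : CellsOp n :=
  ∑ c : Fin n → Fin 2, ∑ d : Fin n → Fin 2,
    ρ c d • tensor fun i => Λ (Matrix.single (c i) (d i) 1)

/-- `Λ^{⊗n}(A₁ ⊗ ⋯ ⊗ Aₙ) = Λ(A₁) ⊗ ⋯ ⊗ Λ(Aₙ)`. -/
theorem channelPower_tensor (Λ : QubitOp →ₗ[ℂ] QubitOp) (n : ℕ) (A : Fin n → QubitOp) :
    channelPower Λ n (tensor A) = tensor fun i => Λ (A i) := by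
  have key : ∀ (B : QubitOp) (x y : Fin 2), Λ B x y
      = ∑ p : Fin 2 × Fin 2, B p.1 p.2 * Λ (Matrix.single p.1 p.2 1) x y := by
    intro B x y
    conv_lhs => rw [Matrix.matrix_eq_sum_single B]
    simp only [map_sum, Matrix.sum_apply, Fintype.sum_prod_type]
    refine Finset.sum_congr rfl fun p _ => Finset.sum_congr rfl fun q _ => ?_
    have : Matrix.single p q (B p q) = B p q • Matrix.single p q (1 : ℂ) := by
      simp [Matrix.smul_single]
    rw [this, map_smul]
    rfl
  ext a b
  simp only [channelPower, tensor, Matrix.sum_apply, Matrix.smul_apply, Matrix.of_apply,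
    smul_eq_mul]
  simp_rw [key (A _), Fintype.prod_sum, Finset.prod_mul_distrib]
  rw [← Fintype.sum_prod_type']
  exact Fintype.sum_equiv (Equiv.arrowProdEquivProdArrow (Fin n) (fun _ => Fin 2)
    (fun _ => Fin 2)).symm _ _ fun _ => rfl

/-- The density matrices of `n` cells whose mean energy is at most `E`. -/
def states (n : ℕ) (E : ℝ) : Set (CellsOp n) := {ρ | IsDensity ρ ∧ energy ρ ≤ E}

/-- The separable density matrices of `n` cells whose mean energy is at most `E`. -/
def separableStates (n : ℕ) (E : ℝ) : Set (CellsOp n) := {ρ ∈ states n E | IsSeparable ρ}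

/-- The maximal asymptotic work/energy ratio for input states `S n E` of `n` cells with energy at
most `E` and figure of merit `W n` of the output:
`limsup_{E → ∞} sup_{n ≥ ⌈E⌉} (max_{ρ ∈ S n E} W n (Λ^{⊗n}(ρ))) / E`, an extended real number. -/
def mawer (S : (n : ℕ) → ℝ → Set (CellsOp n)) (W : (n : ℕ) → CellsOp n → ℝ)
    (Λ : QubitOp →ₗ[ℂ] QubitOp) : EReal :=
  limsup (fun E : ℝ => ⨆ n : ℕ, ⨆ _ : ⌈E⌉₊ ≤ n,
    (⨆ ρ ∈ S n E, ((W n (channelPower Λ n ρ) : ℝ) : EReal)) / (E : EReal)) atTop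

/-- The unrestricted (ergotropic) MAWER. -/
def ergotropicMawer (Λ : QubitOp →ₗ[ℂ] QubitOp) : EReal :=
  mawer states (fun _ => ergotropy) Λ

/-- The separable-input MAWER. -/
def sepMawer (Λ : QubitOp →ₗ[ℂ] QubitOp) : EReal :=
  mawer separableStates (fun _ => ergotropy) Λ

/-- The local MAWER. -/
def locMawer (Λ : QubitOp →ₗ[ℂ] QubitOp) : EReal :=
  mawer states (fun _ => localErgotropy) Λ

/-- The separable-input local MAWER. -/
def locSepMawer (Λ : QubitOp →ₗ[ℂ] QubitOp) : EReal :=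
  mawer separableStates (fun _ => localErgotropy) Λ

/-- The amplitude damping channel `Φ_γ`. -/
def adc (γ : ℝ) : QubitOp →ₗ[ℂ] QubitOp where
  toFun ρ :=
    !![ρ 0 0 + (γ : ℂ) * ρ 1 1, (√(1 - γ) : ℂ) * ρ 0 1;
       (√(1 - γ) : ℂ) * ρ 1 0, (1 - γ : ℂ) * ρ 1 1]
  map_add' ρ σ := by
    ext i j; fin_cases i <;> fin_cases j <;> simp <;> ring
  map_smul' c ρ := by
    ext i j; fin_cases i <;> fin_cases j <;> simp <;> ring

/-- The generalized amplitude damping channel `Φ_{γ,η}`, extended linearly from the density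
matrices (for which `ρ.trace = 1`) to all matrices. -/
def gadc (γ η : ℝ) : QubitOp →ₗ[ℂ] QubitOp where
  toFun ρ :=
    !![(1 - γ * η : ℂ) * ρ.trace - (1 - γ : ℂ) * ρ 1 1, (√(1 - γ) : ℂ) * ρ 0 1;
       (√(1 - γ) : ℂ) * ρ 1 0, (γ * η : ℂ) * ρ.trace + (1 - γ : ℂ) * ρ 1 1]
  map_add' ρ σ := by
    ext i j; fin_cases i <;> fin_cases j <;> simp [Matrix.trace_fin_two] <;> ring
  map_smul' c ρ := by
    ext i j; fin_cases i <;> fin_cases j <;> simp [Matrix.trace_fin_two] <;> ring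

/-- The density matrix of the coherent pure state `√(1 - e) |0⟩ + √e |1⟩`, `e ∈ [0, 1]`. -/
def coherentState (e : ℝ) : QubitOp :=
  Matrix.vecMulVec ![(√(1 - e) : ℂ), (√e : ℂ)] (star ![(√(1 - e) : ℂ), (√e : ℂ)])

/-- The product of `n` copies of the coherent state of energy `E / n`, of total energy `E`. -/
def coherentInput (n : ℕ) (E : ℝ) : CellsOp n := tensor fun _ => coherentState (E / n)

end

end QuantumBattery

open QuantumBattery

namespace QuantumBattery

open Matrix

/-! Write `X = 1 - 2ηγ` and `c = (1 - γ) / X`. The theorem reduces to two estimates: the work is at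
most `c` times the input energy, and coherent product inputs reach `c` up to `O(E/n)`. Together they
pin the inner supremum over `n` to `c` for every `E > 0`, so the limsup is trivial
(`mawer_eq_of_bounds`).

Local operations: the Hamiltonian is a sum of one-cell terms, so a trace-preserving channel followed
by a product unitary yields an energy that depends only on the one-cell marginals. Entanglement is
then irrelevant, and a one-cell inequality suffices (`gadc_qubit_work_le`, from `|σ₀₁|² ≤ σ₀₀σ₁₁`
and AM-GM).

Global operations on separable inputs: the vacuum is sent to the product Gibbs state of excited
population `x = γη` and inverse temperature `β = log ((1 - x)/x)`. By the Gibbs variational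
inequality, a unitary can push the energy below `nx` only by the entropy deficit divided by `β`. A
cell of input energy `e` loses at most `2xβ·c·e` of entropy (`gadc_qubit_entropy`). The output
energy exceeds `nx` by `X·c` times the input energy, so the work is at most `(X + 2x)·c = c` times
it. For fixed `U` this is linear in the state, hence passes to the convex hull. If `γη = 0` the
channel is amplitude damping, and the output energy `(1 - γ)·energy ρ` already bounds the work.

Attainment: a weak coherent input of energy `e` leaves a coherence about `√((1 - γ)e)` across a
population gap about `X`. Rotating it away gains `(1 - γ)e / X` to leading order; heating narrows
the gap and so raises the ratio. -/

/-! ### Tensor products, mean energy and extractable work -/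

theorem tensor_mul {n : ℕ} (A B : Fin n → QubitOp) :
    tensor A * tensor B = tensor fun i => A i * B i := by
  ext a b
  simp only [tensor, Matrix.mul_apply, Matrix.of_apply, ← Finset.prod_mul_distrib]
  rw [← Fintype.prod_sum (fun i c => A i (a i) c * B i c (b i))]

theorem tensor_conjTranspose {n : ℕ} (A : Fin n → QubitOp) :
    (tensor A)ᴴ = tensor fun i => (A i)ᴴ := by
  ext a b
  simp [tensor, Matrix.conjTranspose_apply]

theorem tensor_diagonal {n : ℕ} (d : Fin n → Fin 2 → ℂ) :
    tensor (fun i => diagonal (d i)) = diagonal fun a => ∏ i, d i (a i) := by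
  ext a b
  by_cases hab : a = b
  · simp [tensor, hab]
  · obtain ⟨i, hi⟩ := Function.ne_iff.1 hab
    simp only [tensor, Matrix.of_apply, diagonal_apply_ne _ hab]
    exact Finset.prod_eq_zero (Finset.mem_univ i) (diagonal_apply_ne _ hi)

theorem tensor_one (n : ℕ) : tensor (fun _ : Fin n => (1 : QubitOp)) = 1 := by
  simp only [← diagonal_one]
  rw [tensor_diagonal]
  simp

theorem trace_tensor {n : ℕ} (A : Fin n → QubitOp) : (tensor A).trace = ∏ i, (A i).trace := by
  simp only [Matrix.trace, tensor, Matrix.diag_apply, Matrix.of_apply]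
  rw [← Fintype.prod_sum (fun i c => A i c c)]

/-- The number of excited cells of a product basis vector. -/
def excitations {n : ℕ} (a : Fin n → Fin 2) : ℝ := ∑ i, ((a i : ℕ) : ℝ)

theorem hamiltonian_eq_diagonal (n : ℕ) :
    hamiltonian n = diagonal fun a => (excitations a : ℂ) := by
  have h : ∀ i : Fin n, tensor (Function.update (fun _ => (1 : QubitOp)) i cellHamiltonian)
      = diagonal fun a => (((a i : ℕ) : ℝ) : ℂ) := by
    intro i
    have h1 : (Function.update (fun _ => (1 : QubitOp)) i cellHamiltonian)
        = fun j => diagonal (Function.update (fun _ _ => (1 : ℂ)) i ![0, 1] j) := by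
      funext j
      by_cases hj : j = i
      · subst hj
        ext p q; fin_cases p <;> fin_cases q <;> simp [cellHamiltonian]
      · simp [Function.update_of_ne hj]
    rw [h1, tensor_diagonal]
    congr 1
    funext a
    rw [Fintype.prod_eq_single i]
    · simp only [Function.update_self]
      generalize a i = k
      fin_cases k <;> simp
    · intro j hj
      simp [Function.update_of_ne hj]
  simp only [hamiltonian, h]
  ext a b
  by_cases hab : a = b
  · subst hab; simp [Matrix.sum_apply, excitations]
  · simp [Matrix.sum_apply, hab]

theorem energy_eq_sum {n : ℕ} (ρ : CellsOp n) :
    energy ρ = ∑ a, (ρ a a).re * excitations a := by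
  rw [energy, hamiltonian_eq_diagonal, Matrix.trace, Complex.re_sum]
  simp

theorem energy_nonneg {n : ℕ} {ρ : CellsOp n} (hρ : ρ.PosSemidef) : 0 ≤ energy ρ := by
  rw [energy_eq_sum]
  refine Finset.sum_nonneg fun a _ => mul_nonneg ?_ (Finset.sum_nonneg fun i _ => by positivity)
  exact (Complex.nonneg_iff.1 (hρ.diag_nonneg (i := a))).1

theorem energy_add {n : ℕ} (ρ σ : CellsOp n) : energy (ρ + σ) = energy ρ + energy σ := by
  simp [energy, add_mul]

theorem energy_smul {n : ℕ} (r : ℝ) (ρ : CellsOp n) : energy (r • ρ) = r * energy ρ := by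
  simp [energy]

/-- The marginal of a product distribution. -/
theorem sum_prod_mul_coord {R : Type*} [CommSemiring R] {n : ℕ} (d : Fin n → Fin 2 → R)
    (i : Fin n) (g : Fin 2 → R) :
    ∑ t : Fin n → Fin 2, (∏ j, d j (t j)) * g (t i)
      = (∑ k, d i k * g k) * ∏ j ∈ Finset.univ.erase i, ∑ k, d j k := by
  have h : ∀ t : Fin n → Fin 2, (∏ j, d j (t j)) * g (t i)
      = ∏ j, d j (t j) * (if j = i then g (t j) else 1) := by
    intro t
    rw [Finset.prod_mul_distrib, Finset.prod_ite_eq' Finset.univ i]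
    simp
  simp only [h]
  rw [← Fintype.prod_sum (fun j k => d j k * (if j = i then g k else 1)),
    ← Finset.mul_prod_erase _ _ (Finset.mem_univ i)]
  simp only [if_true]
  congr 1
  refine Finset.prod_congr rfl fun j hj => ?_
  simp [Finset.ne_of_mem_erase hj]

theorem trace_tensor_mul_hamiltonian {n : ℕ} (A : Fin n → QubitOp) :
    (tensor A * hamiltonian n).trace
      = ∑ i, A i 1 1 * ∏ j ∈ Finset.univ.erase i, (A j).trace := by
  have h := fun i => sum_prod_mul_coord (fun j k => A j k k) i (fun k => ((k : ℕ) : ℂ))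
  simp only [Fin.sum_univ_two] at h
  simp only [hamiltonian_eq_diagonal, Matrix.trace, diag_apply, mul_diagonal, excitations,
    Complex.ofReal_sum, Finset.mul_sum, tensor, of_apply]
  rw [Finset.sum_comm]
  refine Finset.sum_congr rfl fun i _ => ?_
  simpa [Fin.sum_univ_two] using h i

theorem energy_tensor {n : ℕ} (A : Fin n → QubitOp) (hA : ∀ i, (A i).trace = 1) :
    energy (tensor A) = ∑ i, (A i 1 1).re := by
  rw [energy, trace_tensor_mul_hamiltonian]
  simp [hA]

theorem trace_unitary_conj {ι : Type*} [Fintype ι] [DecidableEq ι] {U : Matrix ι ι ℂ}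
    (hU : U ∈ unitaryGroup ι ℂ) (A : Matrix ι ι ℂ) : (U * A * Uᴴ).trace = A.trace := by
  rw [trace_mul_comm, ← mul_assoc, ← star_eq_conjTranspose, mem_unitaryGroup_iff'.1 hU, one_mul]

theorem channelPower_add (Λ : QubitOp →ₗ[ℂ] QubitOp) (n : ℕ) (ρ σ : CellsOp n) :
    channelPower Λ n (ρ + σ) = channelPower Λ n ρ + channelPower Λ n σ := by
  simp [channelPower, add_smul, Finset.sum_add_distrib]

theorem channelPower_smul (Λ : QubitOp →ₗ[ℂ] QubitOp) (n : ℕ) (r : ℝ) (ρ : CellsOp n) :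
    channelPower Λ n (r • ρ) = r • channelPower Λ n ρ := by
  simp only [channelPower, Matrix.smul_apply, Finset.smul_sum, smul_assoc]

theorem tensor_single {n : ℕ} (c d : Fin n → Fin 2) :
    tensor (fun i => (Matrix.single (c i) (d i) (1 : ℂ))) = Matrix.single c d 1 := by
  ext a b
  simp only [tensor, of_apply, Matrix.single_apply]
  rw [Finset.prod_ite_zero]
  simp [funext_iff, forall_and]

theorem channelPower_id (n : ℕ) (ρ : CellsOp n) : channelPower LinearMap.id n ρ = ρ := by
  conv_rhs => rw [Matrix.matrix_eq_sum_single ρ]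
  simp [channelPower, tensor_single, Matrix.smul_single]

theorem gadc_trace (γ η : ℝ) (ρ : QubitOp) : (gadc γ η ρ).trace = ρ.trace := by
  simp [gadc, trace_fin_two]
  ring

theorem extractableWork_le {n : ℕ} {𝒰 : Set (CellsOp n)} (h𝒰 : 𝒰.Nonempty) {ρ : CellsOp n} {w : ℝ}
    (h : ∀ U ∈ 𝒰, energy ρ - energy (U * ρ * Uᴴ) ≤ w) : extractableWork 𝒰 ρ ≤ w := by
  have := h𝒰.to_subtype
  exact ciSup_le fun U => h U.1 U.2

theorem localUnitaries_nonempty (n : ℕ) : (localUnitaries n).Nonempty :=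
  ⟨_, fun _ => 1, fun _ => one_mem _, rfl⟩

theorem globalUnitaries_nonempty (n : ℕ) : (globalUnitaries n).Nonempty :=
  (localUnitaries_nonempty n).mono (localUnitaries_subset n)

theorem le_extractableWork {n : ℕ} {𝒰 : Set (CellsOp n)} (h𝒰 : 𝒰 ⊆ globalUnitaries n)
    (ρ : CellsOp n) {U : CellsOp n} (hU : U ∈ 𝒰) :
    energy ρ - energy (U * ρ * Uᴴ) ≤ extractableWork 𝒰 ρ :=
  le_ciSup (bddAbove_work h𝒰 ρ) (⟨U, hU⟩ : 𝒰)

theorem localErgotropy_le_ergotropy {n : ℕ} (ρ : CellsOp n) :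
    localErgotropy ρ ≤ ergotropy ρ :=
  extractableWork_le (localUnitaries_nonempty n) fun _ hU =>
    le_extractableWork subset_rfl ρ (localUnitaries_subset n hU)

/-! ### Partial traces: local operations see only one-cell marginals -/

/-- The reduced operator of the `i`-th cell: the partial trace over all other cells. -/
def reduce {n : ℕ} (i : Fin n) (ρ : CellsOp n) : QubitOp :=
  ∑ r : {j // j ≠ i} → Fin 2,
    ρ.submatrix (fun k => (Equiv.funSplitAt i (Fin 2)).symm (k, r))
      (fun k => (Equiv.funSplitAt i (Fin 2)).symm (k, r))

theorem reduce_posSemidef {n : ℕ} (i : Fin n) {ρ : CellsOp n} (hρ : ρ.PosSemidef) :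
    (reduce i ρ).PosSemidef :=
  posSemidef_sum _ fun _ _ => hρ.submatrix _

/-- The traces of the matrix units on the other cells force `c` and `d` to agree there, which is the
partial trace. This is the form in which the energy of an expanded `channelPower` appears. -/
theorem map_reduce {n : ℕ} (f : QubitOp →ₗ[ℂ] ℂ) (i : Fin n) (ρ : CellsOp n) :
    f (reduce i ρ) = ∑ c, ∑ d, ρ c d * (f (Matrix.single (c i) (d i) 1)
      * ∏ j ∈ Finset.univ.erase i, (Matrix.single (c j) (d j) (1 : ℂ)).trace) := by
  set e := Equiv.funSplitAt i (Fin 2) with he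
  have hself : ∀ p, e.symm p i = p.1 := fun p => by simp [he, Equiv.funSplitAt]
  have hne : ∀ p (j : Fin n) (hj : j ≠ i), e.symm p j = p.2 ⟨j, hj⟩ := fun p j hj => by
    simp [he, Equiv.funSplitAt, Equiv.piSplitAt, hj]
  have hprod : ∀ p q : Fin 2 × ({j // j ≠ i} → Fin 2),
      ∏ j ∈ Finset.univ.erase i, (Matrix.single (e.symm p j) (e.symm q j) (1 : ℂ)).trace
        = if p.2 = q.2 then 1 else 0 := by
    intro p q
    have h1 : ∀ x y : Fin 2, (Matrix.single x y (1 : ℂ)).trace = if x = y then 1 else 0 := by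
      intro x y
      fin_cases x <;> fin_cases y <;> simp [trace_fin_two, Matrix.single]
    simp only [h1]
    rw [Finset.prod_ite_zero, Finset.prod_const_one]
    congr 1
    simp only [Finset.mem_erase, Finset.mem_univ, and_true, eq_iff_iff]
    constructor
    · intro h
      funext j
      have := h j.1 j.2
      rwa [hne _ _ j.2, hne _ _ j.2] at this
    · intro h j hj
      rw [hne _ _ hj, hne _ _ hj, h]
  have hrhs : (∑ c, ∑ d, ρ c d * (f (Matrix.single (c i) (d i) 1)
      * ∏ j ∈ Finset.univ.erase i, (Matrix.single (c j) (d j) (1 : ℂ)).trace))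
      = ∑ x, ∑ r, ∑ y, ρ (e.symm (x, r)) (e.symm (y, r)) * f (Matrix.single x y 1) := by
    rw [← e.symm.sum_comp, Fintype.sum_prod_type]
    refine Finset.sum_congr rfl fun x _ => Finset.sum_congr rfl fun r _ => ?_
    rw [← e.symm.sum_comp, Fintype.sum_prod_type]
    refine Finset.sum_congr rfl fun y _ => ?_
    simp only [hprod, hself]
    rw [Finset.sum_eq_single r]
    · simp
    · intro s _ hs
      simp [hs.symm]
    · simp
  rw [hrhs]
  conv_lhs => rw [Matrix.matrix_eq_sum_single (reduce i ρ)]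
  have h2 : ∀ (x y : Fin 2) (z : ℂ), Matrix.single x y z = z • Matrix.single x y (1 : ℂ) := by
    intro x y z
    simp [Matrix.smul_single]
  simp only [map_sum]
  refine Finset.sum_congr rfl fun x _ => ?_
  rw [Finset.sum_comm]
  refine Finset.sum_congr rfl fun y _ => ?_
  rw [h2, map_smul, smul_eq_mul, reduce, Matrix.sum_apply, Finset.sum_mul]
  rfl

/-- Each term of the Hamiltonian probes one cell, and on the others the channel and the rotation
only preserve the trace. Thus the bound on local work needs no separability. -/
theorem trace_tensor_conj_channelPower {n : ℕ} {Λ : QubitOp →ₗ[ℂ] QubitOp}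
    (hΛ : ∀ A, (Λ A).trace = A.trace) {V : Fin n → QubitOp}
    (hV : ∀ i, V i ∈ unitaryGroup (Fin 2) ℂ) (ρ : CellsOp n) :
    (tensor V * channelPower Λ n ρ * (tensor V)ᴴ * hamiltonian n).trace
      = ∑ i, (V i * Λ (reduce i ρ) * (V i)ᴴ) 1 1 := by
  have h1 : tensor V * channelPower Λ n ρ * (tensor V)ᴴ = ∑ c, ∑ d, ρ c d •
      tensor fun i => V i * Λ (Matrix.single (c i) (d i) 1) * (V i)ᴴ := by
    simp only [channelPower, Finset.mul_sum, Finset.sum_mul, tensor_conjTranspose, tensor_mul,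
      Matrix.mul_smul, Matrix.smul_mul]
  let f : Fin n → QubitOp →ₗ[ℂ] ℂ := fun i =>
    { toFun := fun X => (V i * Λ X * (V i)ᴴ) 1 1
      map_add' := fun X Y => by simp only [map_add, mul_add, add_mul, Matrix.add_apply]
      map_smul' := fun c X => by
        simp only [map_smul, Matrix.mul_smul, Matrix.smul_mul, Matrix.smul_apply,
          RingHom.id_apply] }
  rw [h1]
  simp only [Finset.sum_mul, Matrix.smul_mul, trace_sum, trace_smul, smul_eq_mul,
    trace_tensor_mul_hamiltonian, trace_unitary_conj (hV _), hΛ, Finset.mul_sum]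
  have h2 : ∀ i, (V i * Λ (reduce i ρ) * (V i)ᴴ) 1 1 = f i (reduce i ρ) := fun i => rfl
  simp only [h2, map_reduce]
  rw [Finset.sum_comm (s := (Finset.univ : Finset (Fin n)))]
  refine Finset.sum_congr rfl fun c _ => ?_
  rw [Finset.sum_comm]
  rfl

theorem energy_tensor_conj_channelPower {n : ℕ} {Λ : QubitOp →ₗ[ℂ] QubitOp}
    (hΛ : ∀ A, (Λ A).trace = A.trace) {V : Fin n → QubitOp}
    (hV : ∀ i, V i ∈ unitaryGroup (Fin 2) ℂ) (ρ : CellsOp n) :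
    energy (tensor V * channelPower Λ n ρ * (tensor V)ᴴ)
      = ∑ i, ((V i * Λ (reduce i ρ) * (V i)ᴴ) 1 1).re := by
  rw [energy, trace_tensor_conj_channelPower hΛ hV, Complex.re_sum]

theorem energy_channelPower {n : ℕ} {Λ : QubitOp →ₗ[ℂ] QubitOp}
    (hΛ : ∀ A, (Λ A).trace = A.trace) (ρ : CellsOp n) :
    energy (channelPower Λ n ρ) = ∑ i, (Λ (reduce i ρ) 1 1).re := by
  have := energy_tensor_conj_channelPower hΛ (V := fun _ : Fin n => 1) (fun _ => one_mem _) ρ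
  simpa [tensor_one] using this

theorem energy_eq_sum_reduce {n : ℕ} (ρ : CellsOp n) :
    energy ρ = ∑ i, (reduce i ρ 1 1).re := by
  have := energy_channelPower (Λ := LinearMap.id) (fun _ => rfl) ρ
  rwa [channelPower_id] at this

/-! ### Entropy estimates for a single cell -/

/-- The entries of a positive semidefinite operator of a single cell. -/
theorem qubit_posSemidef {σ : QubitOp} (hσ : σ.PosSemidef) :
    0 ≤ (σ 0 0).re ∧ 0 ≤ (σ 1 1).re ∧ (σ 0 0).im = 0 ∧ (σ 1 1).im = 0 ∧ σ 1 0 = star (σ 0 1) ∧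
      ‖σ 0 1‖ ^ 2 ≤ (σ 0 0).re * (σ 1 1).re := by
  have h0 := Complex.nonneg_iff.1 (hσ.diag_nonneg (i := 0))
  have h1 := Complex.nonneg_iff.1 (hσ.diag_nonneg (i := 1))
  have h2 : σ 1 0 = star (σ 0 1) := (hσ.1.apply 1 0).symm
  refine ⟨h0.1, h1.1, h0.2.symm, h1.2.symm, h2, ?_⟩
  have h3 := (Complex.nonneg_iff.1 hσ.det_nonneg).1
  rw [det_fin_two, h2] at h3
  have h4 : ‖σ 0 1‖ ^ 2 = (σ 0 1).re ^ 2 + (σ 0 1).im ^ 2 := by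
    rw [← Complex.normSq_eq_norm_sq, Complex.normSq_apply]; ring
  simp [← h0.2, ← h1.2] at h3
  rw [h4]
  nlinarith

/-- A comparison of `artanh X / X` with `artanh L / L`, via the integrands of
`artanh L / L = ∫₀¹ dt / (1 - L² t²)`. -/
theorem mul_log_le_mul_log {X L w : ℝ} (hX : 0 < X) (hX1 : X < 1) (hL : 0 < L) (hL1 : L < 1)
    (hw1 : w ≤ 1) (h : L ^ 2 = X - X * (1 - X) * w ^ 2) :
    w * X * (Real.log (1 + L) - Real.log (1 - L))
      ≤ L * (Real.log (1 + X) - Real.log (1 - X)) := by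
  -- `g 0 = 0` and `0 ≤ g 1` is the claim, so it is enough that `g` is monotone; its derivative
  -- compares the two integrands.
  let g : ℝ → ℝ := fun t => L * (Real.log (1 + X * t) - Real.log (1 - X * t))
    - w * X * (Real.log (1 + L * t) - Real.log (1 - L * t))
  have hlog : ∀ Y : ℝ, 0 < Y → Y < 1 → ∀ t ∈ Set.Icc (0 : ℝ) 1,
      HasDerivAt (fun t => Real.log (1 + Y * t) - Real.log (1 - Y * t))
        (2 * Y / (1 - Y ^ 2 * t ^ 2)) t ∧ 0 < 1 - Y ^ 2 * t ^ 2 := by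
    intro Y hY0 hY1 t ht
    have h1 : 0 < 1 + Y * t := by nlinarith [mul_nonneg hY0.le ht.1]
    have h2 : 0 < 1 - Y * t := by nlinarith [mul_le_mul_of_nonneg_left ht.2 hY0.le]
    have h3 : 1 - Y ^ 2 * t ^ 2 = (1 + Y * t) * (1 - Y * t) := by ring
    refine ⟨?_, h3 ▸ mul_pos h1 h2⟩
    have d1 : HasDerivAt (fun t => 1 + Y * t) Y t := by
      simpa using ((hasDerivAt_id t).const_mul Y).const_add 1
    have d2 : HasDerivAt (fun t => 1 - Y * t) (-Y) t := by
      simpa using ((hasDerivAt_id t).const_mul Y).const_sub 1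
    refine ((d1.log h1.ne').sub (d2.log h2.ne')).congr_deriv ?_
    rw [h3]
    field_simp
    ring
  have hg : ∀ t ∈ Set.Icc (0 : ℝ) 1, HasDerivAt g
      (L * (2 * X / (1 - X ^ 2 * t ^ 2)) - w * X * (2 * L / (1 - L ^ 2 * t ^ 2))) t := fun t ht =>
    ((hlog X hX hX1 t ht).1.const_mul L).sub ((hlog L hL hL1 t ht).1.const_mul (w * X))
  have hmono : MonotoneOn g (Set.Icc 0 1) := by
    refine monotoneOn_of_deriv_nonneg (convex_Icc 0 1)
      (fun t ht => (hg t ht).continuousAt.continuousWithinAt)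
      (fun t ht => (hg t (interior_subset ht)).differentiableAt.differentiableWithinAt) ?_
    intro t ht
    replace ht := interior_subset ht
    rw [(hg t ht).deriv]
    have pX := (hlog X hX hX1 t ht).2
    have pL := (hlog L hL hL1 t ht).2
    have ht2 : t ^ 2 ≤ 1 := by nlinarith [ht.1, ht.2]
    -- Eliminating `L ^ 2` through `h` writes the difference as a sum of products of nonnegative
    -- factors; `w` may be negative.
    have key : w * (1 - X ^ 2 * t ^ 2) ≤ 1 - L ^ 2 * t ^ 2 := by
      have e1 : 1 - L ^ 2 * t ^ 2 - w * (1 - X ^ 2 * t ^ 2)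
          = (1 - w) * (1 - t ^ 2) + t ^ 2 * ((1 - X) * ((1 - w) * (1 - X * w))) := by
        rw [h]; ring
      have e2 : 0 ≤ 1 - X * w := by nlinarith
      have e3 : 0 ≤ 1 - w := by linarith
      have e4 : 0 ≤ 1 - X := by linarith
      have e5 : 0 ≤ 1 - t ^ 2 := by linarith
      have : 0 ≤ (1 - w) * (1 - t ^ 2) + t ^ 2 * ((1 - X) * ((1 - w) * (1 - X * w))) := by
        positivity
      linarith
    have : L * (2 * X / (1 - X ^ 2 * t ^ 2)) - w * X * (2 * L / (1 - L ^ 2 * t ^ 2))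
        = 2 * X * L * ((1 - L ^ 2 * t ^ 2) - w * (1 - X ^ 2 * t ^ 2))
          / ((1 - X ^ 2 * t ^ 2) * (1 - L ^ 2 * t ^ 2)) := by
      field_simp
    rw [this]
    have : 0 ≤ (1 - L ^ 2 * t ^ 2) - w * (1 - X ^ 2 * t ^ 2) := by linarith
    positivity
  have := hmono (Set.left_mem_Icc.2 zero_le_one) (Set.right_mem_Icc.2 zero_le_one) zero_le_one
  simp only [g, mul_zero, add_zero, sub_zero, Real.log_one, sub_self, mul_one] at this
  linarith

/-- The entropy of a single cell after damping at infinite temperature decreases at most linearly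
in the input energy `e`. -/
theorem binEntropy_le_add_mul {X e : ℝ} (hX : 0 < X) (hX1 : X < 1) (he0 : 0 ≤ e) (he1 : e ≤ 1) :
    Real.binEntropy ((1 - X) / 2)
      ≤ Real.binEntropy ((1 - √(X ^ 2 + 4 * X * (1 - X) * (e * (1 - e)))) / 2)
        + (1 - X) * (Real.log (1 + X) - Real.log (1 - X)) * e := by
  -- `u e` is the squared Bloch length of a pure state of energy `e` after damping of strength `1 -
  -- X` at `η = 1/2`. The slope in `F` is minus the derivative of the entropy at `e = 0`, so `F' 0 =
  -- 0` and the bound is tangent there.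
  let u : ℝ → ℝ := fun e => X ^ 2 + 4 * X * (1 - X) * (e * (1 - e))
  let F : ℝ → ℝ := fun e => Real.binEntropy ((1 - √(u e)) / 2)
    + (1 - X) * (Real.log (1 + X) - Real.log (1 - X)) * e
  have hX1' : 0 < 1 - X := by linarith
  have hu : ∀ e ∈ Set.Icc (0 : ℝ) 1, 0 < √(u e) ∧ √(u e) < 1 ∧ √(u e) ^ 2 = u e ∧ 0 < u e := by
    intro e he
    have h1 : 0 ≤ e * (1 - e) := mul_nonneg he.1 (by linarith [he.2])
    have h2 : 0 < u e := by positivity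
    have h3 : u e < 1 := by
      have : 4 * (e * (1 - e)) ≤ 1 := by nlinarith [sq_nonneg (1 - 2 * e)]
      have := mul_le_mul_of_nonneg_left this (mul_pos hX hX1').le
      simp only [u]
      nlinarith
    exact ⟨Real.sqrt_pos.2 h2, (Real.sqrt_lt' one_pos).2 (by simpa using h3), Real.sq_sqrt h2.le, h2⟩
  have hF : ∀ e ∈ Set.Icc (0 : ℝ) 1, HasDerivAt F
      ((1 - X) / √(u e) * (√(u e) * (Real.log (1 + X) - Real.log (1 - X))
        - (1 - 2 * e) * X * (Real.log (1 + √(u e)) - Real.log (1 - √(u e))))) e := by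
    intro e he
    obtain ⟨p1, p2, p3, p4⟩ := hu e he
    have d1 : HasDerivAt u (4 * X * (1 - X) * (1 - 2 * e)) e := by
      have := (((hasDerivAt_id e).mul ((hasDerivAt_id e).const_sub 1)).const_mul
        (4 * X * (1 - X))).const_add (X ^ 2)
      refine this.congr_deriv ?_
      simp only [id]
      ring
    have d2 := ((d1.sqrt p4.ne').const_sub 1).div_const 2
    have d3 := Real.hasDerivAt_binEntropy (p := (1 - √(u e)) / 2) (by linarith) (by linarith)
    have d4 := (d3.comp e d2).add
      ((hasDerivAt_id e).const_mul ((1 - X) * (Real.log (1 + X) - Real.log (1 - X))))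
    refine d4.congr_deriv ?_
    have e1 : Real.log (1 - (1 - √(u e)) / 2) = Real.log (1 + √(u e)) - Real.log 2 := by
      rw [← Real.log_div (by linarith) two_ne_zero]; ring_nf
    rw [e1, Real.log_div (by linarith) two_ne_zero]
    field_simp
    ring
  have hmono : MonotoneOn F (Set.Icc 0 1) := by
    refine monotoneOn_of_deriv_nonneg (convex_Icc 0 1)
      (fun t ht => (hF t ht).continuousAt.continuousWithinAt)
      (fun t ht => (hF t (interior_subset ht)).differentiableAt.differentiableWithinAt) ?_
    intro e he
    replace he := interior_subset he
    rw [(hF e he).deriv]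
    obtain ⟨p1, p2, p3, p4⟩ := hu e he
    refine mul_nonneg (by positivity) (sub_nonneg.2 ?_)
    refine mul_log_le_mul_log hX hX1 p1 p2 (by linarith [he.1]) ?_
    rw [p3]
    simp only [u]
    ring
  have := hmono (Set.left_mem_Icc.2 zero_le_one) ⟨he0, he1⟩ he0
  simpa [F, u, Real.sqrt_sq hX.le] using this

/-- The Shannon entropy of a two-point distribution is bounded below through the product of its
weights. -/
theorem binEntropy_le_sum_negMulLog {d : Fin 2 → ℝ} (hd : ∀ k, 0 ≤ d k) (hsum : d 0 + d 1 = 1)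
    {u : ℝ} (hu : u ≤ 1) (h : 1 - u ≤ 4 * (d 0 * d 1)) :
    Real.binEntropy ((1 - √u) / 2) ≤ ∑ k, Real.negMulLog (d k) := by
  -- For the smaller weight `p` the hypothesis reads `(1 - 2p)² ≤ u`, so `p ≥ (1 - √u)/2`, and
  -- binary entropy increases up to `1/2`.
  have aux : ∀ p : ℝ, 0 ≤ p → p ≤ 1 / 2 → 1 - u ≤ 4 * (p * (1 - p)) →
      Real.binEntropy ((1 - √u) / 2) ≤ Real.binEntropy p := by
    intro p hp0 hp1 hp
    have h1 : 1 - 2 * p ≤ √u := Real.le_sqrt_of_sq_le (by nlinarith)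
    have h2 : √u ≤ 1 := Real.sqrt_le_one.2 hu
    exact Real.binEntropy_strictMonoOn.monotoneOn
      ⟨by linarith, by linarith [Real.sqrt_nonneg u]⟩ ⟨hp0, by linarith⟩ (by linarith)
  have e1 : d 1 = 1 - d 0 := by linarith
  rw [Fin.sum_univ_two, e1, ← Real.binEntropy_eq_negMulLog_add_negMulLog_one_sub]
  rcases le_total (d 0) (1 / 2) with h0 | h0
  · exact aux _ (hd 0) h0 (by rwa [e1] at h)
  · rw [← Real.binEntropy_one_sub (d 0)]
    refine aux (1 - d 0) (by linarith [hd 1]) (by linarith) (h.trans_eq ?_)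
    rw [e1]; ring

/-! ### The Gibbs variational inequality for product spectra -/

/-- With its column counterpart, this makes the squared moduli of a unitary a doubly stochastic
matrix. The Gibbs inequality then only involves classical distributions. -/
theorem sum_norm_sq_row {ι : Type*} [Fintype ι] [DecidableEq ι] {U : Matrix ι ι ℂ}
    (hU : U ∈ unitaryGroup ι ℂ) (s : ι) : ∑ t, ‖U s t‖ ^ 2 = 1 := by
  have h := congrFun (congrFun (mem_unitaryGroup_iff.1 hU) s) s
  simp only [mul_apply, star_apply, one_apply_eq, RCLike.star_def, Complex.mul_conj,
    Complex.normSq_eq_norm_sq] at h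
  exact_mod_cast h

theorem sum_norm_sq_column {ι : Type*} [Fintype ι] [DecidableEq ι] {U : Matrix ι ι ℂ}
    (hU : U ∈ unitaryGroup ι ℂ) (t : ι) : ∑ s, ‖U s t‖ ^ 2 = 1 := by
  have := sum_norm_sq_row (Unitary.star_mem hU) t
  simpa [star_apply] using this

theorem conj_diagonal_apply_self {ι : Type*} [Fintype ι] [DecidableEq ι] (U : Matrix ι ι ℂ)
    (D : ι → ℝ) (s : ι) :
    (U * diagonal (fun t => (D t : ℂ)) * Uᴴ) s s = ((∑ t, ‖U s t‖ ^ 2 * D t : ℝ) : ℂ) := by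
  rw [mul_apply]
  simp only [mul_diagonal, conjTranspose_apply, Complex.ofReal_sum]
  refine Finset.sum_congr rfl fun t _ => ?_
  rw [mul_right_comm, RCLike.star_def, Complex.mul_conj, Complex.normSq_eq_norm_sq]
  push_cast
  rfl

/-- The Gibbs variational inequality. -/
theorem sum_negMulLog_le {ι : Type*} [Fintype ι] [DecidableEq ι] {U : Matrix ι ι ℂ}
    (hU : U ∈ unitaryGroup ι ℂ) {D Q : ι → ℝ} (hD : ∀ t, 0 ≤ D t) (hQ : ∀ s, 0 < Q s)
    (hDs : ∑ t, D t = 1) (hQs : ∑ s, Q s = 1) :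
    ∑ t, Real.negMulLog (D t) ≤ ∑ s, (∑ t, ‖U s t‖ ^ 2 * D t) * (-Real.log (Q s)) := by
  have pt : ∀ d q : ℝ, 0 ≤ d → 0 < q → Real.negMulLog d ≤ d * (-Real.log q) + q - d := by
    intro d q hd hq
    rcases hd.eq_or_lt with rfl | hd
    · simpa using hq.le
    · have h := Real.log_le_sub_one_of_pos (div_pos hq hd)
      rw [Real.log_div hq.ne' hd.ne'] at h
      have h2 := mul_le_mul_of_nonneg_left h hd.le
      have h3 : d * (q / d - 1) = q - d := by field_simp
      rw [Real.negMulLog]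
      linarith
  have h1 : ∑ t, Real.negMulLog (D t) = ∑ s, ∑ t, ‖U s t‖ ^ 2 * Real.negMulLog (D t) := by
    rw [Finset.sum_comm]
    refine Finset.sum_congr rfl fun t _ => ?_
    rw [← Finset.sum_mul, sum_norm_sq_column hU, one_mul]
  have h2 : ∑ s, ∑ t, ‖U s t‖ ^ 2 * Q s = 1 := by
    simp only [← Finset.sum_mul, sum_norm_sq_row hU, one_mul, hQs]
  have h3 : ∑ s, ∑ t, ‖U s t‖ ^ 2 * D t = 1 := by
    rw [Finset.sum_comm]
    simp only [← Finset.sum_mul, sum_norm_sq_column hU, one_mul, hDs]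
  calc ∑ t, Real.negMulLog (D t)
      = ∑ s, ∑ t, ‖U s t‖ ^ 2 * Real.negMulLog (D t) := h1
    _ ≤ ∑ s, ∑ t, ‖U s t‖ ^ 2 * (D t * (-Real.log (Q s)) + Q s - D t) :=
        Finset.sum_le_sum fun s _ => Finset.sum_le_sum fun t _ =>
          mul_le_mul_of_nonneg_left (pt _ _ (hD t) (hQ s)) (sq_nonneg _)
    _ = ∑ s, (∑ t, ‖U s t‖ ^ 2 * D t) * (-Real.log (Q s))
          + (∑ s, ∑ t, ‖U s t‖ ^ 2 * Q s - ∑ s, ∑ t, ‖U s t‖ ^ 2 * D t) := by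
        rw [← Finset.sum_sub_distrib, ← Finset.sum_add_distrib]
        refine Finset.sum_congr rfl fun s _ => ?_
        rw [Finset.sum_mul, ← Finset.sum_sub_distrib, ← Finset.sum_add_distrib]
        exact Finset.sum_congr rfl fun t _ => by ring
    _ = _ := by rw [h2, h3, sub_self, add_zero]

/-- The entropy of a product distribution is additive. -/
theorem sum_negMulLog_prod {n : ℕ} {d : Fin n → Fin 2 → ℝ} (hsum : ∀ i, ∑ k, d i k = 1) :
    ∑ t : Fin n → Fin 2, Real.negMulLog (∏ i, d i (t i)) = ∑ i, ∑ k, Real.negMulLog (d i k) := by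
  have h : ∀ t : Fin n → Fin 2, Real.negMulLog (∏ i, d i (t i))
      = ∑ i, (∏ j, d j (t j)) * (-Real.log (d i (t i))) := by
    intro t
    by_cases h0 : ∏ i, d i (t i) = 0
    · simp [h0]
    · rw [Real.negMulLog, Real.log_prod fun i hi => Finset.prod_ne_zero_iff.1 h0 i hi,
        ← Finset.mul_sum, Finset.sum_neg_distrib]
      ring
  simp only [h]
  rw [Finset.sum_comm]
  refine Finset.sum_congr rfl fun i _ => ?_
  rw [sum_prod_mul_coord d i fun k => -Real.log (d i k)]
  simp [hsum, Real.negMulLog]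

/-- The energy of any state with a product spectrum is bounded below by its free energy. -/
theorem sum_negMulLog_le_energy {n : ℕ} {x : ℝ} (hx0 : 0 < x) (hx1 : x < 1)
    {d : Fin n → Fin 2 → ℝ} (hd : ∀ i k, 0 ≤ d i k) (hsum : ∀ i, ∑ k, d i k = 1)
    {U : CellsOp n} (hU : U ∈ globalUnitaries n) :
    ∑ i, ∑ k, Real.negMulLog (d i k)
      ≤ (Real.log (1 - x) - Real.log x)
          * energy (U * diagonal (fun a => ((∏ i, d i (a i) : ℝ) : ℂ)) * Uᴴ)
        - n * Real.log (1 - x) := by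
  have hq : ∀ k, 0 < (![1 - x, x] : Fin 2 → ℝ) k := by
    intro k; fin_cases k <;> simp [hx0, hx1]
  have hprod : ∀ f : Fin n → Fin 2 → ℝ, (∀ i, ∑ k, f i k = 1) →
      ∑ t : Fin n → Fin 2, ∏ i, f i (t i) = 1 := by
    intro f hf
    rw [← Fintype.prod_sum]
    simp [hf]
  -- The reference distribution is the product Gibbs one of excited population `x`: its negative
  -- logarithm is affine in the excitation number, which turns relative entropy into energy.
  have hlog : ∀ s : Fin n → Fin 2, -Real.log (∏ i, (![1 - x, x] : Fin 2 → ℝ) (s i))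
      = (Real.log (1 - x) - Real.log x) * excitations s - n * Real.log (1 - x) := by
    intro s
    have : ∀ k : Fin 2, Real.log ((![1 - x, x] : Fin 2 → ℝ) k)
        = Real.log (1 - x) - (Real.log (1 - x) - Real.log x) * ((k : ℕ) : ℝ) := by
      intro k; fin_cases k <;> simp
    rw [Real.log_prod fun i _ => (hq _).ne']
    simp only [this, Finset.sum_sub_distrib, ← Finset.mul_sum, excitations]
    simp
  have h := sum_negMulLog_le (D := fun t => ∏ i, d i (t i))
    (Q := fun t => ∏ i, (![1 - x, x] : Fin 2 → ℝ) (t i)) hU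
    (fun t => Finset.prod_nonneg fun i _ => hd i _) (fun t => Finset.prod_pos fun i _ => hq _)
    (hprod d hsum) (hprod _ fun i => by simp [Fin.sum_univ_two])
  rw [sum_negMulLog_prod hsum] at h
  refine h.trans_eq ?_
  simp only [hlog]
  have h3 : ∑ s, ∑ t, ‖U s t‖ ^ 2 * ∏ i, d i (t i) = 1 := by
    rw [Finset.sum_comm]
    simp only [← Finset.sum_mul, sum_norm_sq_column hU, one_mul, hprod d hsum]
  simp only [energy_eq_sum, conj_diagonal_apply_self, Complex.ofReal_re, mul_sub,
    Finset.sum_sub_distrib, ← Finset.sum_mul, h3, one_mul]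
  congr 1
  rw [Finset.mul_sum]
  exact Finset.sum_congr rfl fun s _ => by ring

/-- The spectral decomposition of a density matrix of a single cell. -/
theorem exists_qubit_spectrum {τ : QubitOp} (hτ : IsDensity τ) :
    ∃ V ∈ unitaryGroup (Fin 2) ℂ, ∃ d : Fin 2 → ℝ, (∀ k, 0 ≤ d k) ∧ d 0 + d 1 = 1 ∧
      d 0 * d 1 = τ.det.re ∧ τ = V * diagonal (fun k => (d k : ℂ)) * Vᴴ := by
  have hH := hτ.1.1
  refine ⟨hH.eigenvectorUnitary, hH.eigenvectorUnitary.2, hH.eigenvalues,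
    hτ.1.eigenvalues_nonneg, ?_, ?_, hH.spectral_theorem⟩
  · have h := hH.trace_eq_sum_eigenvalues
    rw [hτ.2, Fin.sum_univ_two] at h
    simpa using (congrArg Complex.re h).symm
  · have h := hH.det_eq_prod_eigenvalues
    rw [Fin.prod_univ_two] at h
    simpa using (congrArg Complex.re h).symm

/-- The energy of any state unitarily equivalent to a product state, in terms of lower bounds for
the entropies of the cells. -/
theorem sum_le_energy_conj_tensor {n : ℕ} {x : ℝ} (hx0 : 0 < x) (hx1 : x < 1)
    {τ : Fin n → QubitOp} (hτ : ∀ i, IsDensity (τ i)) {s : Fin n → ℝ}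
    (hs : ∀ i, ∀ d : Fin 2 → ℝ, (∀ k, 0 ≤ d k) → d 0 + d 1 = 1 → d 0 * d 1 = (τ i).det.re →
      s i ≤ ∑ k, Real.negMulLog (d k))
    {U : CellsOp n} (hU : U ∈ globalUnitaries n) :
    ∑ i, s i ≤ (Real.log (1 - x) - Real.log x) * energy (U * tensor τ * Uᴴ)
        - n * Real.log (1 - x) := by
  choose V hV d hd hsum hdet hdiag using fun i => exists_qubit_spectrum (hτ i)
  have h1 : tensor τ
      = tensor V * diagonal (fun a => ((∏ i, d i (a i) : ℝ) : ℂ)) * (tensor V)ᴴ := by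
    push_cast
    rw [← tensor_diagonal fun i k => (d i k : ℂ), tensor_conjTranspose, tensor_mul, tensor_mul]
    exact congrArg tensor (funext hdiag)
  have h2 : U * tensor τ * Uᴴ
      = (U * tensor V) * diagonal (fun a => ((∏ i, d i (a i) : ℝ) : ℂ)) * (U * tensor V)ᴴ := by
    rw [h1, conjTranspose_mul]
    simp only [mul_assoc]
  have hVU : tensor V ∈ globalUnitaries n := localUnitaries_subset n ⟨V, hV, rfl⟩
  rw [h2]
  refine le_trans ?_ (sum_negMulLog_le_energy hx0 hx1 hd
    (fun i => by rw [Fin.sum_univ_two, hsum i]) (U := U * tensor V) ?_)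
  · exact Finset.sum_le_sum fun i _ => hs i _ (hd i) (hsum i) (hdet i)
  · exact (unitaryGroup (Fin n → Fin 2) ℂ).mul_mem hU hVU

/-! ### Positivity of the damping channels and the zero-temperature bound -/

/-- The Kraus operators of the amplitude damping channel. -/
noncomputable def adcKraus (γ : ℝ) : Fin 2 → QubitOp :=
  ![!![1, 0; 0, (√(1 - γ) : ℂ)], !![0, (√γ : ℂ); 0, 0]]

theorem adc_eq_kraus {γ : ℝ} (hγ₀ : 0 ≤ γ) (hγ₁ : γ ≤ 1) (A : QubitOp) :
    adc γ A = ∑ k, adcKraus γ k * A * (adcKraus γ k)ᴴ := by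
  have h1 : (√γ : ℂ) * (√γ : ℂ) = γ := by
    rw [← Complex.ofReal_mul, Real.mul_self_sqrt hγ₀]
  have h2 : (√(1 - γ) : ℂ) * (√(1 - γ) : ℂ) = 1 - γ := by
    rw [← Complex.ofReal_mul, Real.mul_self_sqrt (by linarith)]; push_cast; ring
  ext i j
  simp only [Matrix.sum_apply, Matrix.mul_apply, Fin.sum_univ_two, conjTranspose_apply]
  revert i j
  simp only [Fin.forall_fin_two]
  simp [adc, adcKraus]
  refine ⟨⟨?_, ?_⟩, ?_⟩
  · linear_combination (-A 1 1) * h1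
  · ring
  · linear_combination (-A 1 1) * h2

theorem adc_posSemidef {γ : ℝ} (hγ₀ : 0 ≤ γ) (hγ₁ : γ ≤ 1) {A : QubitOp} (hA : A.PosSemidef) :
    (adc γ A).PosSemidef := by
  rw [adc_eq_kraus hγ₀ hγ₁]
  exact posSemidef_sum _ fun k _ => hA.mul_mul_conjTranspose_same _

theorem gadc_entries {γ η : ℝ} (A : QubitOp) :
    gadc γ η A 0 0 = (1 - γ * η) * A.trace - (1 - γ) * A 1 1 ∧
    gadc γ η A 0 1 = (√(1 - γ) : ℂ) * A 0 1 ∧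
    gadc γ η A 1 0 = (√(1 - γ) : ℂ) * A 1 0 ∧
    gadc γ η A 1 1 = γ * η * A.trace + (1 - γ) * A 1 1 :=
  ⟨rfl, rfl, rfl, rfl⟩

theorem adc_entries (γ : ℝ) (A : QubitOp) :
    adc γ A 0 0 = A 0 0 + γ * A 1 1 ∧ adc γ A 0 1 = (√(1 - γ) : ℂ) * A 0 1 ∧
    adc γ A 1 0 = (√(1 - γ) : ℂ) * A 1 0 ∧ adc γ A 1 1 = (1 - γ) * A 1 1 :=
  ⟨rfl, rfl, rfl, rfl⟩

/-- Finite temperature is a mixture of decay to the ground state and decay to the excited state, the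
latter being amplitude damping conjugated by the flip `Fin.rev`. Positivity follows from that of
`adc`. -/
theorem gadc_eq_mixture (γ η : ℝ) (A : QubitOp) :
    gadc γ η A = (1 - η) • adc γ A
      + η • (adc γ (A.submatrix Fin.rev Fin.rev)).submatrix Fin.rev Fin.rev := by
  obtain ⟨g0, g1, g2, g3⟩ := gadc_entries (γ := γ) (η := η) A
  obtain ⟨a0, a1, a2, a3⟩ := adc_entries γ A
  obtain ⟨b0, b1, b2, b3⟩ := adc_entries γ (A.submatrix Fin.rev Fin.rev)
  have r0 : Fin.rev (0 : Fin 2) = 1 := rfl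
  have r1 : Fin.rev (1 : Fin 2) = 0 := rfl
  ext i j
  revert i j
  simp only [Fin.forall_fin_two, Matrix.add_apply, Matrix.smul_apply, submatrix_apply, r0, r1,
    Complex.real_smul, g0, g1, g2, g3, a0, a1, a2, a3, b0, b1, b2, b3, trace_fin_two,
    Complex.ofReal_sub, Complex.ofReal_one]
  refine ⟨⟨?_, ?_⟩, ?_, ?_⟩ <;> ring

theorem gadc_posSemidef {γ η : ℝ} (hγ₀ : 0 ≤ γ) (hγ₁ : γ ≤ 1) (hη₀ : 0 ≤ η) (hη₁ : η ≤ 1)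
    {A : QubitOp} (hA : A.PosSemidef) : (gadc γ η A).PosSemidef := by
  rw [gadc_eq_mixture]
  exact ((adc_posSemidef hγ₀ hγ₁ hA).smul (sub_nonneg.2 hη₁)).add
    (((adc_posSemidef hγ₀ hγ₁ (hA.submatrix _)).submatrix _).smul hη₀)

/-- Covers the case excluded from the entropy argument, where the reference Gibbs state would have
infinite `β`. -/
theorem adc_eq_gadc {γ η : ℝ} (h : γ * η = 0) : gadc γ η = adc γ := by
  have h' : (γ : ℂ) * η = 0 := by exact_mod_cast h
  refine LinearMap.ext fun A => ?_
  obtain ⟨g0, g1, g2, g3⟩ := gadc_entries (γ := γ) (η := η) A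
  obtain ⟨a0, a1, a2, a3⟩ := adc_entries γ A
  ext i j
  revert i j
  simp only [Fin.forall_fin_two, g0, g1, g2, g3, a0, a1, a2, a3, trace_fin_two, h']
  refine ⟨⟨?_, trivial⟩, trivial, ?_⟩ <;> ring

/-- Tensor powers of the amplitude damping channel are positive. -/
theorem channelPower_adc_posSemidef {γ : ℝ} (hγ₀ : 0 ≤ γ) (hγ₁ : γ ≤ 1) {n : ℕ} {ρ : CellsOp n}
    (hρ : ρ.PosSemidef) : (channelPower (adc γ) n ρ).PosSemidef := by
  -- The tensor power has a Kraus form indexed by words `κ` of one-cell Kraus labels.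
  have h : channelPower (adc γ) n ρ = ∑ κ : Fin n → Fin 2,
      tensor (fun i => adcKraus γ (κ i)) * ρ * (tensor fun i => adcKraus γ (κ i))ᴴ := by
    have hs : ∀ c d : Fin n → Fin 2, (tensor fun i => adc γ (Matrix.single (c i) (d i) 1))
        = ∑ κ : Fin n → Fin 2, tensor (fun i => adcKraus γ (κ i)) * Matrix.single c d 1
            * (tensor fun i => adcKraus γ (κ i))ᴴ := by
      intro c d
      simp only [← tensor_single, tensor_conjTranspose, tensor_mul, adc_eq_kraus hγ₀ hγ₁]
      ext a b
      simp only [tensor, of_apply, Matrix.sum_apply]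
      rw [Fintype.prod_sum]
    simp only [channelPower, hs, Finset.smul_sum]
    conv_rhs => rw [Matrix.matrix_eq_sum_single ρ]
    simp only [Finset.mul_sum, Finset.sum_mul]
    conv_rhs => rw [Finset.sum_comm]
    refine Finset.sum_congr rfl fun c _ => ?_
    rw [Finset.sum_comm]
    refine Finset.sum_congr rfl fun κ _ => Finset.sum_congr rfl fun d _ => ?_
    have : Matrix.single c d (ρ c d) = ρ c d • Matrix.single c d (1 : ℂ) := by
      simp [Matrix.smul_single]
    rw [this, Matrix.mul_smul, Matrix.smul_mul]
  rw [h]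
  exact posSemidef_sum _ fun κ _ => hρ.mul_mul_conjTranspose_same _

theorem adc_trace (γ : ℝ) (A : QubitOp) : (adc γ A).trace = A.trace := by
  simp [adc, trace_fin_two]
  ring

/-- The work extractable after amplitude damping is at most the output energy. -/
theorem ergotropy_adc_le {γ : ℝ} (hγ₀ : 0 ≤ γ) (hγ₁ : γ ≤ 1) {n : ℕ} {ρ : CellsOp n}
    (hρ : ρ.PosSemidef) : ergotropy (channelPower (adc γ) n ρ) ≤ (1 - γ) * energy ρ := by
  have h1 : energy (channelPower (adc γ) n ρ) = (1 - γ) * energy ρ := by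
    rw [energy_channelPower (adc_trace γ), energy_eq_sum_reduce, Finset.mul_sum]
    refine Finset.sum_congr rfl fun i _ => ?_
    simp [adc]
  refine extractableWork_le (globalUnitaries_nonempty n) fun U _ => ?_
  have h2 := energy_nonneg
    ((channelPower_adc_posSemidef hγ₀ hγ₁ hρ).mul_mul_conjTranspose_same U)
  linarith

/-! ### Upper bounds on the work after generalized amplitude damping -/

/-- The energy of a rotated cell. -/
theorem qubit_conj_apply_one_one {τ : QubitOp} (hτ : τ.PosSemidef) (V : QubitOp) :
    ‖V 1 0‖ ^ 2 * (τ 0 0).re + ‖V 1 1‖ ^ 2 * (τ 1 1).re - 2 * (‖V 1 0‖ * ‖V 1 1‖ * ‖τ 0 1‖)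
      ≤ ((V * τ * Vᴴ) 1 1).re := by
  obtain ⟨-, -, h0, h1, h2, -⟩ := qubit_posSemidef hτ
  have e : ((V * τ * Vᴴ) 1 1).re = ‖V 1 0‖ ^ 2 * (τ 0 0).re + ‖V 1 1‖ ^ 2 * (τ 1 1).re
      + 2 * (V 1 0 * τ 0 1 * star (V 1 1)).re := by
    simp only [← Complex.normSq_eq_norm_sq, Complex.normSq_apply]
    simp [Matrix.mul_apply, Fin.sum_univ_two, h0, h1, h2]
    ring
  have hb := (abs_le.1 (Complex.abs_re_le_norm (V 1 0 * τ 0 1 * star (V 1 1)))).1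
  rw [norm_mul, norm_mul, norm_star] at hb
  rw [e]
  linarith

section
variable {γ η : ℝ}

/-- The work extracted from a single damped cell by a unitary. -/
theorem gadc_qubit_work_le (hγ₀ : 0 ≤ γ) (hγ₁ : γ ≤ 1) (hη₀ : 0 ≤ η) (hη₁ : η ≤ 1)
    (hX : 0 < 1 - 2 * η * γ) {σ : QubitOp} (hσ : σ.PosSemidef) {V : QubitOp}
    (hV : V ∈ unitaryGroup (Fin 2) ℂ) :
    (gadc γ η σ 1 1).re - ((V * gadc γ η σ * Vᴴ) 1 1).re
      ≤ (1 - γ) / (1 - 2 * η * γ) * (σ 1 1).re := by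
  obtain ⟨hf, he, hf', he', -, hm⟩ := qubit_posSemidef hσ
  have h1 := qubit_conj_apply_one_one (gadc_posSemidef hγ₀ hγ₁ hη₀ hη₁ hσ) V
  have hrow := sum_norm_sq_row hV 1
  rw [Fin.sum_univ_two] at hrow
  obtain ⟨g0, g1, -, g3⟩ := gadc_entries (γ := γ) (η := η) σ
  have e0 : (gadc γ η σ 0 0).re
      = (1 - γ * η) * ((σ 0 0).re + (σ 1 1).re) - (1 - γ) * (σ 1 1).re := by
    rw [g0]; simp [trace_fin_two]
  have e3 : (gadc γ η σ 1 1).re = γ * η * ((σ 0 0).re + (σ 1 1).re) + (1 - γ) * (σ 1 1).re := by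
    rw [g3]; simp [trace_fin_two]
  have e1 : ‖gadc γ η σ 0 1‖ = √(1 - γ) * ‖σ 0 1‖ := by
    rw [g1, norm_mul, Complex.norm_real, Real.norm_of_nonneg (Real.sqrt_nonneg _)]
  rw [e0, e1, e3] at h1
  rw [e3]
  set f := (σ 0 0).re
  set e := (σ 1 1).re
  set m := ‖σ 0 1‖
  set P := ‖V 1 0‖
  set R := ‖V 1 1‖
  set X := 1 - 2 * η * γ with hXd
  have ha : 0 ≤ 1 - γ := by linarith
  have hsq : √(1 - γ) ^ 2 = 1 - γ := Real.sq_sqrt ha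
  set y := P * R * (√(1 - γ) * m) with hy
  have hA : 0 ≤ P ^ 2 * X * f := by positivity
  have hB : 0 ≤ R ^ 2 * (1 - γ) * e / X := by positivity
  -- The coherence term is split with weights `X` and `1 / X`, so that in AM-GM the
  -- ground-population part `P ^ 2 * X * f` cancels exactly against the population cost of the
  -- rotation.
  have hyAB : y ^ 2 ≤ (P ^ 2 * X * f) * (R ^ 2 * (1 - γ) * e / X) := by
    have e2 : (P ^ 2 * X * f) * (R ^ 2 * (1 - γ) * e / X) = P ^ 2 * R ^ 2 * (1 - γ) * (f * e) := by
      field_simp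
    have e4 : y ^ 2 = P ^ 2 * R ^ 2 * (1 - γ) * m ^ 2 := by
      rw [hy, mul_pow, mul_pow, mul_pow, hsq]; ring
    rw [e2, e4]
    gcongr
  have hAM : 2 * y ≤ P ^ 2 * X * f + R ^ 2 * (1 - γ) * e / X := by
    refine le_of_sq_le_sq ?_ (by positivity)
    nlinarith [sq_nonneg (P ^ 2 * X * f - R ^ 2 * (1 - γ) * e / X)]
  have hfin : 0 ≤ P ^ 2 * e * (X + (1 - γ) / X - 2 * (1 - γ)) := by
    have : X + (1 - γ) / X - 2 * (1 - γ) = ((X - (1 - γ)) ^ 2 + (1 - γ) * γ) / X := by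
      field_simp
      ring
    rw [this]
    positivity
  have hR : R ^ 2 = 1 - P ^ 2 := by linarith
  have e5 : R ^ 2 * (1 - γ) * e / X = (1 - γ) / X * e - P ^ 2 * e * ((1 - γ) / X) := by
    rw [hR]; ring
  rw [hR] at h1
  rw [e5] at hAM
  have hηγ : γ * η = (1 - X) / 2 := by rw [hXd]; ring
  rw [hηγ] at h1 ⊢
  linarith

/-- The local work extractable after generalized amplitude damping. -/
theorem localErgotropy_gadc_le (hγ₀ : 0 ≤ γ) (hγ₁ : γ ≤ 1) (hη₀ : 0 ≤ η) (hη₁ : η ≤ 1)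
    (hX : 0 < 1 - 2 * η * γ) {n : ℕ} {ρ : CellsOp n} (hρ : ρ.PosSemidef) :
    localErgotropy (channelPower (gadc γ η) n ρ)
      ≤ (1 - γ) / (1 - 2 * η * γ) * energy ρ := by
  refine extractableWork_le (localUnitaries_nonempty n) ?_
  rintro _ ⟨V, hV, rfl⟩
  rw [energy_tensor_conj_channelPower (gadc_trace γ η) hV, energy_channelPower (gadc_trace γ η),
    energy_eq_sum_reduce, Finset.mul_sum, ← Finset.sum_sub_distrib]
  exact Finset.sum_le_sum fun i _ =>
    gadc_qubit_work_le hγ₀ hγ₁ hη₀ hη₁ hX (reduce_posSemidef i hρ) (hV i)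

/-- The entropy of a single damped cell. -/
theorem gadc_qubit_entropy (hγ₀ : 0 ≤ γ) (hγ₁ : γ ≤ 1) (hη₁ : η ≤ 1 / 2)
    (hX : 0 < 1 - 2 * η * γ) (hx : 0 < γ * η) {σ : QubitOp} (hσ : IsDensity σ) {d : Fin 2 → ℝ}
    (hd : ∀ k, 0 ≤ d k) (hsum : d 0 + d 1 = 1) (hdet : d 0 * d 1 = (gadc γ η σ).det.re) :
    Real.binEntropy (γ * η) - 2 * (γ * η) * (Real.log (1 - γ * η) - Real.log (γ * η))
        * ((1 - γ) / (1 - 2 * η * γ) * (σ 1 1).re)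
      ≤ ∑ k, Real.negMulLog (d k) := by
  obtain ⟨hf, he, hf', he', hs, hm⟩ := qubit_posSemidef hσ.1
  have htr : (σ 0 0).re + (σ 1 1).re = 1 := by
    have := congrArg Complex.re hσ.2
    simpa [trace_fin_two] using this
  have hdet' : (gadc γ η σ).det.re = (1 - γ * η - (1 - γ) * (σ 1 1).re)
      * (γ * η + (1 - γ) * (σ 1 1).re) - (1 - γ) * ‖σ 0 1‖ ^ 2 := by
    obtain ⟨g0, g1, g2, g3⟩ := gadc_entries (γ := γ) (η := η) σ
    have h4 : ((√(1 - γ) : ℂ) * σ 0 1) * ((√(1 - γ) : ℂ) * star (σ 0 1))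
        = (((1 - γ) * ‖σ 0 1‖ ^ 2 : ℝ) : ℂ) := by
      have h5 : (√(1 - γ) : ℂ) * (√(1 - γ) : ℂ) = ((1 - γ : ℝ) : ℂ) := by
        rw [← Complex.ofReal_mul, Real.mul_self_sqrt (by linarith)]
      have h6 : σ 0 1 * star (σ 0 1) = ((‖σ 0 1‖ ^ 2 : ℝ) : ℂ) := by
        rw [RCLike.star_def, Complex.mul_conj, Complex.normSq_eq_norm_sq]
      rw [mul_mul_mul_comm, h5, h6, Complex.ofReal_mul]
    rw [det_fin_two, g0, g1, g2, g3, hs, h4, hσ.2, Complex.sub_re, Complex.ofReal_re]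
    simp [he']
  rw [hdet'] at hdet
  set e := (σ 1 1).re
  set m := ‖σ 0 1‖
  set X := 1 - 2 * η * γ with hXd
  have hx' : γ * η = (1 - X) / 2 := by rw [hXd]; ring
  have hX1 : X < 1 := by linarith
  have haX : 1 - γ ≤ X := by rw [hXd]; nlinarith
  have ha : 0 ≤ 1 - γ := by linarith
  have hf1 : (σ 0 0).re = 1 - e := by linarith
  rw [hf1] at hm hf
  -- An effective energy: the output populations are those of damping of strength `1 - X` at `η =
  -- 1/2` on an input of energy `z`. Since `η ≤ 1/2` gives `1 - γ ≤ X`, one has `z ≤ e`, so the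
  -- actual coherence is no larger than that of the pure state of energy `z`.
  set z := (1 - γ) / X * e with hz
  have hz0 : 0 ≤ z := by positivity
  have hz1 : z ≤ 1 :=
    mul_le_one₀ ((div_le_one hX).2 haX) he (by linarith)
  have key : 1 - (X ^ 2 + 4 * X * (1 - X) * (z * (1 - z))) ≤ 4 * (d 0 * d 1) := by
    rw [hdet, hx']
    have hXz : (1 - γ) * e = X * z := by rw [hz]; field_simp
    have h1 : (1 - γ) * m ^ 2 ≤ X * z * (1 - e) := by
      rw [← hXz, mul_assoc]
      exact mul_le_mul_of_nonneg_left (by linarith) ha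
    have h2 : 0 ≤ X * z * (e - z) := by
      have : z ≤ e := by
        rw [hz]
        exact mul_le_of_le_one_left he ((div_le_one hX).2 haX)
      exact mul_nonneg (by positivity) (by linarith)
    rw [hXz]
    nlinarith
  have hu : X ^ 2 + 4 * X * (1 - X) * (z * (1 - z)) ≤ 1 := by
    have h1 : 4 * (z * (1 - z)) ≤ 1 := by nlinarith [sq_nonneg (1 - 2 * z)]
    have h2 := mul_le_mul_of_nonneg_left h1 (mul_pos hX (sub_pos.2 hX1)).le
    nlinarith
  have h1 := binEntropy_le_add_mul hX hX1 hz0 hz1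
  have h2 := binEntropy_le_sum_negMulLog hd hsum hu key
  have e1 : Real.log (1 - γ * η) = Real.log (1 + X) - Real.log 2 := by
    rw [← Real.log_div (by linarith) two_ne_zero, hx']; ring_nf
  have e2 : Real.log (γ * η) = Real.log (1 - X) - Real.log 2 := by
    rw [← Real.log_div (by linarith) two_ne_zero, hx']
  rw [e1, e2, hx']
  linarith

/-- The work extractable from a damped product state by a global unitary. -/
theorem gadc_product_work_le (hγ₀ : 0 ≤ γ) (hγ₁ : γ ≤ 1) (hη₁ : η ≤ 1 / 2)
    (hX : 0 < 1 - 2 * η * γ) (hx : 0 < γ * η) {n : ℕ} {σ : Fin n → QubitOp}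
    (hσ : ∀ i, IsDensity (σ i)) {U : CellsOp n} (hU : U ∈ globalUnitaries n) :
    energy (channelPower (gadc γ η) n (tensor σ))
        - energy (U * channelPower (gadc γ η) n (tensor σ) * Uᴴ)
      ≤ (1 - γ) / (1 - 2 * η * γ) * energy (tensor σ) := by
  have hη₀ : 0 ≤ η := by
    by_contra! h
    nlinarith
  have hτ : ∀ i, IsDensity (gadc γ η (σ i)) := fun i =>
    ⟨gadc_posSemidef hγ₀ hγ₁ hη₀ (by linarith) (hσ i).1, by rw [gadc_trace, (hσ i).2]⟩
  rw [channelPower_tensor, energy_tensor _ fun i => (hτ i).2, energy_tensor _ fun i => (hσ i).2]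
  have hx2 : γ * η < 1 / 2 := by linarith
  have h := sum_le_energy_conj_tensor hx (by linarith) hτ
    (fun i d hd hsum hdet => gadc_qubit_entropy hγ₀ hγ₁ hη₁ hX hx (hσ i) hd hsum hdet) hU
  set β := Real.log (1 - γ * η) - Real.log (γ * η) with hβd
  have hβ : 0 < β := sub_pos.2 (Real.log_lt_log hx (by linarith))
  have hent : Real.binEntropy (γ * η) = -Real.log (1 - γ * η) + β * (γ * η) := by
    rw [Real.binEntropy_eq_negMulLog_add_negMulLog_one_sub, Real.negMulLog, Real.negMulLog, hβd]
    ring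
  have hout : ∀ i, (gadc γ η (σ i) 1 1).re = γ * η + (1 - γ) * (σ i 1 1).re := by
    intro i
    rw [(gadc_entries (σ i)).2.2.2, (hσ i).2]
    simp
  simp only [hout, Finset.sum_add_distrib, Finset.sum_sub_distrib, ← Finset.mul_sum,
    Finset.sum_const, Finset.card_univ, Fintype.card_fin, nsmul_eq_mul, hent] at h ⊢
  set S := ∑ i, (σ i 1 1).re
  set N := energy (U * (tensor fun i => gadc γ η (σ i)) * Uᴴ)
  refine le_of_mul_le_mul_left ?_ hβ
  -- Splits the total: the excess output energy supplies `1 - 2γη` of `c * S`, and the entropy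
  -- deficit in `h`, after division by `β`, supplies the remaining `2γη`.
  have e1 : (1 - γ) * S = (1 - 2 * (γ * η)) * ((1 - γ) / (1 - 2 * η * γ) * S) := by
    have : 1 - 2 * (γ * η) = 1 - 2 * η * γ := by ring
    rw [this, ← mul_assoc, mul_div_assoc', mul_div_cancel_left₀ _ hX.ne']
  rw [e1]
  nlinarith

/-- The work extractable after generalized amplitude damping of a separable state. -/
theorem ergotropy_gadc_le (hγ₀ : 0 ≤ γ) (hγ₁ : γ ≤ 1) (hη₁ : η ≤ 1 / 2)
    (hX : 0 < 1 - 2 * η * γ) (hx : 0 < γ * η) {n : ℕ} {ρ : CellsOp n} (hρ : IsSeparable ρ) :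
    ergotropy (channelPower (gadc γ η) n ρ) ≤ (1 - γ) / (1 - 2 * η * γ) * energy ρ := by
  refine extractableWork_le (globalUnitaries_nonempty n) fun U hU => ?_
  -- For fixed `U` the defect is linear in the state, so its nonpositivity extends from product
  -- states to their convex hull.
  have hlin : IsLinearMap ℝ fun ρ : CellsOp n => energy (channelPower (gadc γ η) n ρ)
      - energy (U * channelPower (gadc γ η) n ρ * Uᴴ)
      - (1 - γ) / (1 - 2 * η * γ) * energy ρ := by
    constructor
    · intro ρ σ
      simp only [channelPower_add, energy_add, mul_add, add_mul]
      ring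
    · intro r ρ
      simp only [channelPower_smul, energy_smul, Matrix.mul_smul, Matrix.smul_mul, smul_eq_mul]
      ring
  have hsub := convexHull_min (s := {τ : CellsOp n | ∃ σ : Fin n → QubitOp,
    (∀ i, IsDensity (σ i)) ∧ τ = tensor σ}) ?_ (convex_halfSpace_le hlin 0)
  · have := hsub hρ
    simp only [Set.mem_ofPred_eq] at this
    linarith
  · rintro _ ⟨σ, hσ, rfl⟩
    simp only [Set.mem_ofPred_eq]
    linarith [gadc_product_work_le hγ₀ hγ₁ hη₁ hX hx hσ hU]

end

/-! ### Coherent product inputs and the lower bound -/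

theorem coherentState_entries (e : ℝ) (he₀ : 0 ≤ e) (he₁ : e ≤ 1) :
    coherentState e 0 0 = ((1 - e : ℝ) : ℂ) ∧
    coherentState e 0 1 = ((√(1 - e) * √e : ℝ) : ℂ) ∧
    coherentState e 1 0 = ((√(1 - e) * √e : ℝ) : ℂ) ∧
    coherentState e 1 1 = (e : ℂ) := by
  have h0 : (√e : ℂ) * (√e : ℂ) = e := by
    rw [← Complex.ofReal_mul, Real.mul_self_sqrt he₀]
  have h1 : (√(1 - e) : ℂ) * (√(1 - e) : ℂ) = ((1 - e : ℝ) : ℂ) := by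
    rw [← Complex.ofReal_mul, Real.mul_self_sqrt (by linarith)]
  refine ⟨?_, ?_, ?_, ?_⟩
  · simpa [coherentState, vecMulVec_apply] using h1
  · simp [coherentState, vecMulVec_apply]
  · simp [coherentState, vecMulVec_apply, mul_comm]
  · simpa [coherentState, vecMulVec_apply] using h0

theorem coherentState_isDensity {e : ℝ} (he₀ : 0 ≤ e) (he₁ : e ≤ 1) :
    IsDensity (coherentState e) := by
  refine ⟨posSemidef_vecMulVec_self_star _, ?_⟩
  obtain ⟨h0, -, -, h1⟩ := coherentState_entries e he₀ he₁
  rw [trace_fin_two, h0, h1]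
  push_cast
  ring

theorem coherentInput_mem {n : ℕ} {E : ℝ} (hE : 0 < E) (hn : E ≤ n) :
    coherentInput n E ∈ separableStates n E ∧ energy (coherentInput n E) = E := by
  have hn0 : (0 : ℝ) < n := hE.trans_le hn
  have he₀ : 0 ≤ E / n := by positivity
  have he₁ : E / n ≤ 1 := (div_le_one hn0).2 hn
  have hd := coherentState_isDensity he₀ he₁
  have hen : energy (coherentInput n E) = E := by
    rw [coherentInput, energy_tensor _ fun _ => hd.2,
      (coherentState_entries _ he₀ he₁).2.2.2]
    simp only [Complex.ofReal_re, Finset.sum_const, Finset.card_univ, Fintype.card_fin,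
      nsmul_eq_mul]
    field_simp
  refine ⟨⟨⟨⟨?_, ?_⟩, hen.le⟩, subset_convexHull ℝ _ ⟨_, fun _ => hd, rfl⟩⟩, hen⟩
  · have h : coherentState (E / n) = vecMulVec ![(√(1 - E / n) : ℂ), (√(E / n) : ℂ)]
        (star ![(√(1 - E / n) : ℂ), (√(E / n) : ℂ)]) := rfl
    have h2 : coherentInput n E
        = vecMulVec (fun a : Fin n → Fin 2 => ∏ i, ![(√(1 - E / n) : ℂ), (√(E / n) : ℂ)] (a i))
          (star fun a : Fin n → Fin 2 => ∏ i, ![(√(1 - E / n) : ℂ), (√(E / n) : ℂ)] (a i)) := by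
      ext a b
      simp only [coherentInput, tensor, of_apply, h, vecMulVec_apply, Pi.star_apply, star_prod,
        Finset.prod_mul_distrib]
    rw [h2]
    exact posSemidef_vecMulVec_self_star _
  · rw [coherentInput, trace_tensor]
    simp [hd.2]

section
variable {γ η : ℝ}

/-- A rotation extracting work from a damped coherent state of small energy. -/
theorem exists_unitary_coherent_work_ge (hγ₁ : γ ≤ 1) (hX : 0 < 1 - 2 * η * γ)
    {e : ℝ} (he₀ : 0 ≤ e) (he₁ : e ≤ 1) :
    ∃ V ∈ unitaryGroup (Fin 2) ℂ,
      (1 - γ) / (1 - 2 * η * γ) * e * (1 - (2 + (1 - γ) / (1 - 2 * η * γ) ^ 2) * e)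
        ≤ (gadc γ η (coherentState e) 1 1).re
          - ((V * gadc γ η (coherentState e) * Vᴴ) 1 1).re := by
  have ha : 0 ≤ 1 - γ := by linarith
  obtain ⟨c0, c1, c2, c3⟩ := coherentState_entries e he₀ he₁
  obtain ⟨g0, g1, g2, g3⟩ := gadc_entries (γ := γ) (η := η) (coherentState e)
  rw [(coherentState_isDensity he₀ he₁).2] at g0 g3
  rw [c1] at g1
  rw [c2] at g2
  rw [c3] at g0 g3
  set X := 1 - 2 * η * γ with hXd
  -- The tangent of the rotation angle: coherence over population gap, which diagonalizes the output
  -- to first order in `√e`. The cosine is `k`, and the unitary used is the real reflection with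
  -- these entries.
  set r := √(1 - γ) * √e / X with hr
  have hrX : √(1 - γ) * √e = r * X := by rw [hr]; field_simp
  have hr2 : r ^ 2 * X ^ 2 = (1 - γ) * e := by
    rw [← mul_pow, ← hrX, mul_pow, Real.sq_sqrt ha, Real.sq_sqrt he₀]
  set k := 1 / √(1 + r ^ 2) with hk
  have hk2 : k ^ 2 = 1 / (1 + r ^ 2) := by
    rw [hk, div_pow, one_pow, Real.sq_sqrt (by positivity)]
  have hk1 : k ^ 2 * (1 + r ^ 2) = 1 := by rw [hk2]; field_simp
  refine ⟨!![(k : ℂ), (r * k : ℝ); (r * k : ℝ), (-k : ℝ)], ?_, ?_⟩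
  · rw [mem_unitaryGroup_iff]
    have hkC : (k : ℂ) * k + r * k * (r * k) = 1 := by
      have : k * k + r * k * (r * k) = 1 := by linarith
      exact_mod_cast this
    ext i j
    simp only [Matrix.mul_apply, Fin.sum_univ_two, star_apply, one_apply]
    revert i j
    simp only [Fin.forall_fin_two]
    simp
    refine ⟨⟨?_, ?_⟩, ?_, ?_⟩
    · exact hkC
    · ring
    · ring
    · linear_combination hkC
  · have e1 : ((!![(k : ℂ), (r * k : ℝ); (r * k : ℝ), (-k : ℝ)] * gadc γ η (coherentState e)
        * !![(k : ℂ), (r * k : ℝ); (r * k : ℝ), (-k : ℝ)]ᴴ) 1 1)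
        = ((r ^ 2 * k ^ 2 * (1 - γ * η - (1 - γ) * e) + k ^ 2 * (γ * η + (1 - γ) * e)
          - 2 * (r * k ^ 2) * (√(1 - γ) * (√(1 - e) * √e)) : ℝ) : ℂ) := by
      simp only [Matrix.mul_apply, Fin.sum_univ_two, conjTranspose_apply, g0, g1, g2, g3]
      simp
      ring
    have e2 : gadc γ η (coherentState e) 1 1 = ((γ * η + (1 - γ) * e : ℝ) : ℂ) := by
      rw [g3]; push_cast; ring
    rw [e1, e2, Complex.ofReal_re, Complex.ofReal_re]
    -- Source of the error constant: this bound costs `2 * e`, and the normalization `k ^ 2 ≥ 1 - r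
    -- ^ 2` costs `r ^ 2 = (1 - γ) / X ^ 2 * e`.
    have hs : 1 - e ≤ √(1 - e) := Real.le_sqrt_of_sq_le (by nlinarith)
    have e3 : √(1 - γ) * (√(1 - e) * √e) = r * X * √(1 - e) := by rw [← hrX]; ring
    have e4 : γ * η = (1 - X) / 2 := by rw [hXd]; ring
    have e5 : γ * η + (1 - γ) * e - (r ^ 2 * k ^ 2 * (1 - γ * η - (1 - γ) * e)
          + k ^ 2 * (γ * η + (1 - γ) * e) - 2 * (r * k ^ 2) * (√(1 - γ) * (√(1 - e) * √e)))
        = r ^ 2 * k ^ 2 * (-X + 2 * ((1 - γ) * e) + 2 * X * √(1 - e)) := by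
      rw [e3, e4]
      linear_combination (-((1 - X) / 2 + (1 - γ) * e)) * hk1
    rw [e5]
    have e6 : r ^ 2 * k ^ 2 * (X * (1 - 2 * e))
        ≤ r ^ 2 * k ^ 2 * (-X + 2 * ((1 - γ) * e) + 2 * X * √(1 - e)) := by
      refine mul_le_mul_of_nonneg_left ?_ (by positivity)
      nlinarith [mul_le_mul_of_nonneg_left hs hX.le, mul_nonneg ha he₀]
    refine le_trans ?_ e6
    have e7 : (1 - γ) / X * e = r ^ 2 * X := by
      rw [div_mul_eq_mul_div, ← hr2]; field_simp
    have e8 : (1 - γ) / X ^ 2 * e = r ^ 2 := by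
      rw [div_mul_eq_mul_div, ← hr2]; field_simp
    have e9 : 1 - (2 + (1 - γ) / X ^ 2) * e = 1 - 2 * e - r ^ 2 := by
      rw [← e8]; ring
    rw [e7, e9]
    have e10 : 1 - 2 * e - r ^ 2 ≤ k ^ 2 * (1 - 2 * e) := by
      rw [hk2, div_mul_eq_mul_div, one_mul, le_div_iff₀ (by positivity)]
      nlinarith [mul_nonneg (sq_nonneg r) he₀, sq_nonneg (r ^ 2)]
    calc r ^ 2 * X * (1 - 2 * e - r ^ 2) ≤ r ^ 2 * X * (k ^ 2 * (1 - 2 * e)) :=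
          mul_le_mul_of_nonneg_left e10 (by positivity)
      _ = _ := by ring

/-- The local work extractable from damped coherent product inputs. -/
theorem le_localErgotropy_coherentInput (hγ₁ : γ ≤ 1) (hX : 0 < 1 - 2 * η * γ)
    {E : ℝ} {n : ℕ} (hE : 0 < E) (hn : E ≤ n) :
    (1 - γ) / (1 - 2 * η * γ)
        - (1 - γ) / (1 - 2 * η * γ) * (2 + (1 - γ) / (1 - 2 * η * γ) ^ 2) * (E / n)
      ≤ localErgotropy (channelPower (gadc γ η) n (coherentInput n E)) / E := by
  have hn0 : (0 : ℝ) < n := hE.trans_le hn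
  have he₀ : 0 ≤ E / n := by positivity
  have he₁ : E / n ≤ 1 := (div_le_one hn0).2 hn
  obtain ⟨V, hV, hwork⟩ := exists_unitary_coherent_work_ge hγ₁ hX he₀ he₁
  have hd := coherentState_isDensity he₀ he₁
  have htr : (gadc γ η (coherentState (E / n))).trace = 1 := by rw [gadc_trace, hd.2]
  have h := le_extractableWork (localUnitaries_subset n)
    (channelPower (gadc γ η) n (coherentInput n E)) (U := tensor fun _ => V)
    ⟨_, fun _ => hV, rfl⟩
  rw [coherentInput, channelPower_tensor, tensor_conjTranspose, tensor_mul, tensor_mul,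
    energy_tensor _ fun _ => htr,
    energy_tensor _ fun _ => by rw [trace_unitary_conj hV, htr]] at h
  simp only [Finset.sum_const, Finset.card_univ, Fintype.card_fin, nsmul_eq_mul] at h
  rw [le_div_iff₀ hE, coherentInput, channelPower_tensor]
  refine le_trans ?_ h
  rw [← mul_sub]
  refine le_trans (le_of_eq ?_) (mul_le_mul_of_nonneg_left hwork hn0.le)
  generalize (1 - γ) / (1 - 2 * η * γ) ^ 2 = p
  generalize (1 - γ) / (1 - 2 * η * γ) = q
  field_simp

/-- The work extractable after generalized amplitude damping of a separable state of bounded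
energy. -/
theorem ergotropy_gadc_le_mul (hγ₀ : 0 ≤ γ) (hγ₁ : γ ≤ 1) (hη₀ : 0 ≤ η) (hη₁ : η ≤ 1 / 2)
    (hX : 0 < 1 - 2 * η * γ) {n : ℕ} {E : ℝ} {ρ : CellsOp n} (hρ : ρ ∈ separableStates n E) :
    ergotropy (channelPower (gadc γ η) n ρ) ≤ (1 - γ) / (1 - 2 * η * γ) * E := by
  refine le_trans ?_ (mul_le_mul_of_nonneg_left hρ.1.2 (div_nonneg (by linarith) hX.le))
  rcases (mul_nonneg hγ₀ hη₀).eq_or_lt with hx | hx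
  · rw [adc_eq_gadc hx.symm]
    have h1 : 1 - 2 * η * γ = 1 := by linarith
    rw [h1, div_one]
    exact ergotropy_adc_le hγ₀ hγ₁ hρ.1.1.1
  · exact ergotropy_gadc_le hγ₀ hγ₁ hη₁ hX hx hρ.2

end

/-! ### From two-sided bounds to the MAWERs -/

/-- A linear upper bound on the extractable work which is attained asymptotically determines the
MAWER. -/
theorem mawer_eq_of_bounds {S : (n : ℕ) → ℝ → Set (CellsOp n)} {W : (n : ℕ) → CellsOp n → ℝ}
    {Λ : QubitOp →ₗ[ℂ] QubitOp} {c C : ℝ}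
    (hub : ∀ (n : ℕ) (E : ℝ), ∀ ρ ∈ S n E, W n (channelPower Λ n ρ) ≤ c * E)
    (hlb : ∀ (E : ℝ) (n : ℕ), 0 < E → E ≤ n →
      ∃ ρ ∈ S n E, c - C * (E / n) ≤ W n (channelPower Λ n ρ) / E) :
    mawer S W Λ = (c : EReal) := by
  -- The function of `E` is eventually constant: at fixed `E > 0`, letting `n → ∞` removes the error
  -- `C * (E / n)` inside the supremum.
  refine (limsup_congr ?_).trans (limsup_const (c : EReal))
  filter_upwards [eventually_gt_atTop 0] with E hE
  have hE' : (0 : EReal) < (E : EReal) := by exact_mod_cast hE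
  refine le_antisymm (iSup₂_le fun n _ => ?_) ?_
  · rw [EReal.div_le_iff_le_mul hE' (EReal.coe_ne_top E)]
    refine iSup₂_le fun ρ hρ => ?_
    rw [← EReal.coe_mul, EReal.coe_le_coe_iff, mul_comm]
    exact hub n E ρ hρ
  · have hlim : Tendsto (fun n : ℕ => ((c - C * (E / n) : ℝ) : EReal)) atTop (𝓝 (c : EReal)) := by
      refine (continuous_coe_real_ereal.tendsto c).comp ?_
      simpa using ((tendsto_const_div_atTop_nhds_zero_nat E).const_mul C).const_sub c
    refine le_of_tendsto hlim ?_
    filter_upwards [eventually_ge_atTop ⌈E⌉₊] with n hn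
    obtain ⟨ρ, hρ, h⟩ := hlb E n hE (Nat.ceil_le.1 hn)
    refine le_trans ?_ (le_iSup₂ (f := fun (n : ℕ) (_ : ⌈E⌉₊ ≤ n) =>
      (⨆ ρ ∈ S n E, ((W n (channelPower Λ n ρ) : ℝ) : EReal)) / (E : EReal)) n hn)
    refine (EReal.coe_le_coe_iff.2 h).trans ?_
    rw [EReal.coe_div]
    exact EReal.div_le_div_right_of_nonneg hE'.le
      (le_iSup₂ (f := fun (ρ : CellsOp n) (_ : ρ ∈ S n E) =>
        ((W n (channelPower Λ n ρ) : ℝ) : EReal)) ρ hρ)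

end QuantumBattery

theorem mainTheorem6 (γ η : ℝ) (hγ₀ : 0 ≤ γ) (hγ₁ : γ ≤ 1) (hη₀ : 0 ≤ η) (hη₁ : η ≤ 1 / 2)
    (hne : 1 - 2 * η * γ ≠ 0) :
    -- the three restricted MAWERs of the GADC
    (sepMawer (gadc γ η) = (((1 - γ) / (1 - 2 * η * γ) : ℝ) : EReal) ∧
      locMawer (gadc γ η) = (((1 - γ) / (1 - 2 * η * γ) : ℝ) : EReal) ∧
      locSepMawer (gadc γ η) = (((1 - γ) / (1 - 2 * η * γ) : ℝ) : EReal)) ∧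
    -- the coherent product inputs are admissible, with energy exactly `E`
    (∀ (E : ℝ) (n : ℕ), 0 < E → E ≤ n →
      coherentInput n E ∈ separableStates n E ∧ energy (coherentInput n E) = E) ∧
    -- they attain the value as `n → ∞`, with global and with local operations
    (∀ E : ℝ, 0 < E →
      Tendsto (fun n : ℕ => ergotropy (channelPower (gadc γ η) n (coherentInput n E)) / E)
        atTop (𝓝 ((1 - γ) / (1 - 2 * η * γ))) ∧
      Tendsto (fun n : ℕ => localErgotropy (channelPower (gadc γ η) n (coherentInput n E)) / E)
        atTop (𝓝 ((1 - γ) / (1 - 2 * η * γ)))) ∧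
    -- and the error is `O(E / n)`
    (∃ C : ℝ, ∀ (E : ℝ) (n : ℕ), 0 < E → E ≤ n →
      |ergotropy (channelPower (gadc γ η) n (coherentInput n E)) / E
          - (1 - γ) / (1 - 2 * η * γ)| ≤ C * (E / n) ∧
      |localErgotropy (channelPower (gadc γ η) n (coherentInput n E)) / E
          - (1 - γ) / (1 - 2 * η * γ)| ≤ C * (E / n)) ∧
    -- comparison with the unrestricted MAWER of the ADC
    ergotropicMawer (adc γ) = ((1 - γ : ℝ) : EReal) ∧
    (0 < η → 0 < γ → γ < 1 →
      ergotropicMawer (adc γ) < sepMawer (gadc γ η) ∧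
      ergotropicMawer (adc γ) < locMawer (gadc γ η) ∧
      ergotropicMawer (adc γ) < locSepMawer (gadc γ η)) ∧
    -- the infinite-temperature case
    (η = 1 / 2 →
      sepMawer (gadc γ η) = 1 ∧ locMawer (gadc γ η) = 1 ∧ locSepMawer (gadc γ η) = 1) := by
  have hX : 0 < 1 - 2 * η * γ := lt_of_le_of_ne (by nlinarith) hne.symm
  set c := (1 - γ) / (1 - 2 * η * γ) with hc
  set C := c * (2 + (1 - γ) / (1 - 2 * η * γ) ^ 2) with hC
  have hc0 : 0 ≤ c := div_nonneg (by linarith) hX.le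
  have hη₁' : η ≤ 1 := by linarith
  have hC0 : 0 ≤ C := by
    have : 0 ≤ 1 - γ := by linarith
    positivity
  have hlow : ∀ (E : ℝ) (n : ℕ), 0 < E → E ≤ n →
      c - C * (E / n) ≤ localErgotropy (channelPower (gadc γ η) n (coherentInput n E)) / E :=
    fun E n hE hn => le_localErgotropy_coherentInput hγ₁ hX hE hn
  have hlow' : ∀ (E : ℝ) (n : ℕ), 0 < E → E ≤ n →
      c - C * (E / n) ≤ ergotropy (channelPower (gadc γ η) n (coherentInput n E)) / E :=
    fun E n hE hn => (hlow E n hE hn).trans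
      (div_le_div_of_nonneg_right (localErgotropy_le_ergotropy _) hE.le)
  have hup : ∀ (n : ℕ) (E : ℝ), ∀ ρ ∈ separableStates n E,
      ergotropy (channelPower (gadc γ η) n ρ) ≤ c * E :=
    fun n E ρ hρ => ergotropy_gadc_le_mul hγ₀ hγ₁ hη₀ hη₁ hX hρ
  have hsep : sepMawer (gadc γ η) = (c : EReal) := mawer_eq_of_bounds hup
    fun E n hE hn => ⟨_, (coherentInput_mem hE hn).1, hlow' E n hE hn⟩
  have hloc : locMawer (gadc γ η) = (c : EReal) := mawer_eq_of_bounds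
    (fun n E ρ hρ => (localErgotropy_gadc_le hγ₀ hγ₁ hη₀ hη₁' hX hρ.1.1).trans
      (mul_le_mul_of_nonneg_left hρ.2 hc0))
    fun E n hE hn => ⟨_, (coherentInput_mem hE hn).1.1, hlow E n hE hn⟩
  have hlocSep : locSepMawer (gadc γ η) = (c : EReal) := mawer_eq_of_bounds
    (fun n E ρ hρ => (localErgotropy_le_ergotropy _).trans (hup n E ρ hρ))
    fun E n hE hn => ⟨_, (coherentInput_mem hE hn).1, hlow E n hE hn⟩
  have herg : ergotropicMawer (adc γ) = ((1 - γ : ℝ) : EReal) := by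
    refine mawer_eq_of_bounds (C := (1 - γ) * (2 + (1 - γ)))
      (fun n E ρ hρ => (ergotropy_adc_le hγ₀ hγ₁ hρ.1.1).trans
        (mul_le_mul_of_nonneg_left hρ.2 (by linarith)))
      fun E n hE hn => ⟨_, (coherentInput_mem hE hn).1.1, ?_⟩
    -- Amplitude damping is the case `η = 0`, where `X = 1` and `c = 1 - γ`.
    have h := (le_localErgotropy_coherentInput (η := 0) hγ₁ (by norm_num) hE hn).trans
      (div_le_div_of_nonneg_right (localErgotropy_le_ergotropy _) hE.le)
    rw [adc_eq_gadc (mul_zero γ)] at h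
    simpa using h
  have herr : ∀ (E : ℝ) (n : ℕ), 0 < E → E ≤ n →
      |ergotropy (channelPower (gadc γ η) n (coherentInput n E)) / E - c| ≤ C * (E / n) ∧
      |localErgotropy (channelPower (gadc γ η) n (coherentInput n E)) / E - c|
        ≤ C * (E / n) := by
    intro E n hE hn
    have h1 : ergotropy (channelPower (gadc γ η) n (coherentInput n E)) / E ≤ c :=
      (div_le_iff₀ hE).2 (hup n E _ (coherentInput_mem hE hn).1)
    have h2 := div_le_div_of_nonneg_right
      (localErgotropy_le_ergotropy (channelPower (gadc γ η) n (coherentInput n E))) hE.le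
    have h3 : 0 ≤ C * (E / n) := mul_nonneg hC0 (div_nonneg hE.le n.cast_nonneg)
    exact ⟨abs_le.2 ⟨by linarith [hlow' E n hE hn], by linarith⟩,
      abs_le.2 ⟨by linarith [hlow E n hE hn], by linarith⟩⟩
  have hlim : ∀ (E : ℝ) (f : ℕ → ℝ), (∀ n : ℕ, E ≤ n → |f n - c| ≤ C * (E / n)) →
      Tendsto f atTop (𝓝 c) := by
    intro E f hf
    rw [tendsto_iff_dist_tendsto_zero]
    refine squeeze_zero' (.of_forall fun n => dist_nonneg) ?_
      (by simpa using (tendsto_const_div_atTop_nhds_zero_nat E).const_mul C)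
    filter_upwards [eventually_ge_atTop ⌈E⌉₊] with n hn
    exact hf n (Nat.ceil_le.1 hn)
  refine ⟨⟨hsep, hloc, hlocSep⟩, fun E n hE hn => coherentInput_mem hE hn,
    fun E hE => ⟨hlim E _ fun n hn => (herr E n hE hn).1, hlim E _ fun n hn => (herr E n hE hn).2⟩,
    ⟨C, herr⟩, herg, ?_, ?_⟩
  · intro hη hγ hγ'
    have h : ((1 - γ : ℝ) : EReal) < (c : EReal) := by
      rw [EReal.coe_lt_coe_iff, hc, lt_div_iff₀ hX]
      have : 0 < (1 - γ) * (η * γ) := mul_pos (by linarith) (mul_pos hη hγ)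
      linarith
    rw [herg, hsep, hloc, hlocSep]
    exact ⟨h, h, h⟩
  · intro hη
    have h : c = 1 := by
      rw [hc, div_eq_one_iff_eq hne, hη]
      ring
    rw [hsep, hloc, hlocSep, h]
    exact ⟨rfl, rfl, rfl⟩
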